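/- **Setting.** Let $T>0$, $N\ge 1$, $\Delta=T/N$, $t_i=i\Delta$, $x\in\mathbb R^d$. Let $(U_i)_{i\ge1}$ be i.i.d. $\mathbb R^q$-valued random variables with law $\mu$, $\mathbb E[U_1]=0$, $\mathbb E[U_1U_1^*]=I_q$, satisfying for some $\beta>0$ the Gaussian concentration property $GC(\beta)$: $\mathbb E[e^{\lambda f(U_1)}]\le \exp(\lambda\,\mathbb E[f(U_1)]+\beta\lambda^2/4)$ for all $1$-Lipschitz $f:\mathbb R^q\to\mathbb R$ and all $\lambda\ge0$. Let $X^\Delta_0=x$ and $$X^\Delta_{t_{i+1}}=X^\Delta_{t_i}+b(t_i,X^\Delta_{t_i})\Delta+\sigma(t_i,X^\Delta_{t_i})\Delta^{1/2}U_{i+1},\qquad 0\le i\le N-1 ,$$ and let $\mu_T^{\Delta,0,x}$ be the law of $X^\Delta_T$. Matrices carry the norm $|A|=\mathrm{Tr}(AA^*)^{1/2}$. **(HS)** For $t\in[0,T]$, $b(t,\cdot)$ and $\sigma(t,\cdot)$ are Lipschitz with constants $[b]_1,[\sigma]_1\ge0$ independent of $t$ and not both zero (any admissible constants may be used). **(HD$_\alpha$)**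 There are a $\mathcal C^2$ function $V:\mathbb R^d\to(0,\infty)$ and constants $C_V,C_b,C_\sigma>0$, $\eta\ge0$ with $|\nabla V|^2\le C_VV$, $\sup_x\|\nabla^2V(x)\|\le2\eta$ and, for all $x\in\mathbb R^d$, $\sup_{t\in[0,T]}|b(t,x)|^2\le C_bV(x)$ and $\sup_{t\in[0,T]}\mathrm{Tr}(\sigma\sigma^*(t,x))\le C_\sigma V^{1-\alpha}(x)$. **Constants.** Put $C(\Delta)=2[b]_1+[\sigma]_1^2+\Delta[b]_1^2$, $$\varphi=C_\sigma\beta\,\frac{1+C(\Delta)\Delta}{4C(\Delta)}\,e^{3C(\Delta)T},\qquad C=\alpha(C_VC_b)^{1/2}+\beta C_\sigma\alpha^2(1+2\eta\Delta)^2(C_V+C_b)+\alpha\eta C_b\Delta,\qquad K=(C_VC_b)^{1/2}+\eta C_b\Delta .$$ For $\alpha\in(\frac12,1]$ and $\varepsilon>0$ with $\mathbb E[e^{\varepsilon|U_1|^2}]<\infty$, put $\underline\rho=\frac12e^{-CT}\min\big(1,\varepsilon(2\eta\alpha C_\sigma T)^{-1}\big)$ (the minimum being $1$ if $\eta=0$),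 $L=\frac12\log\mathbb E\big[e^{\frac{\varepsilon(1-\alpha)}{2\alpha}|U_1|^2}\big]$, $$\Psi_1=\exp\Big(\tfrac{2\alpha-1}{\alpha}\underline\rho^{-\frac{1-\alpha}{2\alpha-1}}\Big)\exp\Big(\underline\rho\tfrac{1-\alpha}{\alpha}e^{CT}V^\alpha(x)+L\Big)+\Big(V^{1-\alpha}(x)+\Big(\tfrac{C_\sigma\mathbb E[|U_1|^2]}{K}\Big)^{\frac{1-\alpha}{\alpha}}\Big)e^{(1-\alpha)KT},$$ $$\Psi_2=\tfrac{2\alpha-1}{\alpha}\underline\rho^{-\frac{1-\alpha}{2\alpha-1}}+\underline\rho\tfrac{1-\alpha}{\alpha}e^{CT}V^\alpha(x)+L,\qquad K_{1}=\max(\Psi_1,\Psi_2),\qquad \Psi_\alpha=K_{1}\big(\varphi\vee\varphi^{\frac{\alpha}{2\alpha-1}}\big).$$ For $\alpha=\frac12$, call $\ell>0$ admissible if $\ell^2\le e^{-CT}$ and $\mathbb E[\exp(\ell^2\,2\eta\alpha C_\sigma Te^{CT}|U_1|^2)]\le2$, and put $K_{2}=\max\big(1,\ \ell^2e^{CT}(2V^{1/2}(x)+2\eta\alpha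 C_\sigma\mathbb E[|U_1|^2]T)\big)$. **Transport-entropy inequality.** For $\Phi:\mathbb R_+\to\mathbb R_+$ convex and increasing with $\Phi(0)=0$ (extended by $\Phi(\infty)=\infty$), a probability measure $m$ on $\mathbb R^d$ satisfies $T_\Phi$ if $\Phi(W_1(\nu,m))\le H(\nu,m)$ for every probability measure $\nu$ on $\mathbb R^d$. Here $W_1(\nu,m)\in[0,\infty]$ is the infimum of $\int|y-z|\,\pi(dy,dz)$ over couplings $\pi$ of $\nu$ and $m$, and $H(\nu,m)=\int\log\frac{d\nu}{dm}\,d\nu$ if $\nu\ll m$, $H(\nu,m)=+\infty$ otherwise. **Theorem.** Assume the above with $\alpha\in[\frac12,1]$. No non-degeneracy of $\sigma$ is required. There is $\varepsilon>0$ with $\mathbb E[e^{\varepsilon|U_1|^2}]<\infty$, and: * if $\alpha\in(\frac12,1]$, then for every such $\varepsilon$ the law $\mu^{\Delta,0,x}_T$ satisfies $T_{\Phi_\alpha^*}$, where $\Phi^*_\alpha(\lambda)=\sup_{\rho\ge0}\{\lambda\rho-\Phi_\alpha(\rho)\}$ and $\Phi_\alpha(\rho)=\Psi_\alpha\,(\rho^2\vee\rho^{\frac{2\alpha}{2\alpha-1}})$;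 * if $\alpha=\frac12$, then admissible $\ell$ exist and for every admissible $\ell$ the law $\mu^{\Delta,0,x}_T$ satisfies $T_{\Phi_{1/2}^*}$, where $\Phi_{1/2}^*(\lambda)=\sup_{0\le\rho<\varphi^{-1/2}\ell}\{\lambda\rho-\Phi_{1/2}(\rho)\}$ and $$\Phi_{1/2}(\rho)=K_{2}\,\frac{(\rho\varphi^{1/2}/\ell)^2}{1-\rho\varphi^{1/2}/\ell},\qquad 0\le\rho<\varphi^{-1/2}\ell .$$ -/

import Mathlib

open MeasureTheory ProbabilityTheory
open scoped NNReal ENNReal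

noncomputable section

namespace EulerTE

/-! ### Transport-entropy inequalities -/

/-- The Wasserstein distance of order one: the infimum of the transport cost
`∫ |x - y| π(dx, dy)` over all couplings `π` of `μ` and `ν`. -/
def wasserstein1 {n : ℕ} (μ ν : Measure (EuclideanSpace ℝ (Fin n))) : ℝ≥0∞ :=
  ⨅ (π : Measure (EuclideanSpace ℝ (Fin n) × EuclideanSpace ℝ (Fin n)))
    (_ : IsProbabilityMeasure π) (_ : π.map Prod.fst = μ) (_ : π.map Prod.snd = ν),
    ∫⁻ z, edist z.1 z.2 ∂π

/-- The monotone conjugate `Φ*(w) = sup_{ρ ≥ 0} (w ρ - Φ(ρ))`. All functions `Φ` used below vanish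
at `0`, so that the supremum is nonnegative and truncated subtraction does not change it.
The argument `w` may be `∞`. -/
def monotoneConjugate (Φ : ℝ≥0 → ℝ≥0∞) (w : ℝ≥0∞) : ℝ≥0∞ :=
  ⨆ ρ : ℝ≥0, (w * (ρ : ℝ≥0∞) - Φ ρ)

/-- A convex, increasing function `ℝ₊ → ℝ₊` vanishing at `0`, extended by `Φ(∞) = ∞`. -/
structure IsTransportFunction (Φ : ℝ≥0∞ → ℝ≥0∞) : Prop where
  zero : Φ 0 = 0
  finite : ∀ w : ℝ≥0, Φ w ≠ ∞
  top : Φ ∞ = ∞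
  strictMono : StrictMono (fun w : ℝ≥0 => Φ w)
  convex : ConvexOn ℝ≥0 Set.univ (fun w : ℝ≥0 => Φ w)

/-- The transport-entropy inequality `T_Φ`: `Φ(W₁(ν, μ)) ≤ H(ν, μ)` for all probability measures
`ν`, where `H(ν, μ)` is the relative entropy of `ν` with respect to `μ`. -/
def TransportEntropy {n : ℕ} (Φ : ℝ≥0∞ → ℝ≥0∞) (μ : Measure (EuclideanSpace ℝ (Fin n))) : Prop :=
  IsTransportFunction Φ ∧
    ∀ ν : Measure (EuclideanSpace ℝ (Fin n)), IsProbabilityMeasure ν →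
      Φ (wasserstein1 ν μ) ≤ InformationTheory.klDiv ν μ

/-! ### Innovations -/

/-- The Gaussian concentration property `GC(β)`. -/
def GaussianConcentration {q : ℕ} (μ : Measure (EuclideanSpace ℝ (Fin q))) (β : ℝ) : Prop :=
  ∀ f : EuclideanSpace ℝ (Fin q) → ℝ, LipschitzWith 1 f →
    Integrable f μ ∧
    ∀ l : ℝ, 0 ≤ l →
      Integrable (fun u => Real.exp (l * f u)) μ ∧
      ∫ u, Real.exp (l * f u) ∂μ ≤ Real.exp (l * ∫ u, f u ∂μ + β * l ^ 2 / 4)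

/-- Centred, with identity covariance matrix. -/
structure IsStandardized {q : ℕ} (μ : Measure (EuclideanSpace ℝ (Fin q))) : Prop where
  integrable_sq : Integrable (fun u => ‖u‖ ^ 2) μ
  mean : ∀ i : Fin q, ∫ u, u i ∂μ = 0
  cov : ∀ i j : Fin q, ∫ u, u i * u j ∂μ = if i = j then 1 else 0

/-! ### The scheme and its coefficients -/

/-- The Euclidean (Frobenius) norm of a matrix, `(Tr (A Aᵀ))^{1/2}`. -/
def frobeniusNorm {d q : ℕ} (A : Matrix (Fin d) (Fin q) ℝ) : ℝ :=
  Real.sqrt (A * A.transpose).trace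

/-- The Euler-like scheme with time step `Δ`:
`X 0 = x`, `X (i+1) = X i + b (i Δ, X i) Δ + σ (i Δ, X i) Δ^{1/2} U i`.
Here `U i` is the innovation of the step from `i Δ` to `(i+1) Δ`, usually numbered `i+1`. -/
def eulerScheme {d q : ℕ} {Ω : Type*}
    (b : ℝ → EuclideanSpace ℝ (Fin d) → EuclideanSpace ℝ (Fin d))
    (σ : ℝ → EuclideanSpace ℝ (Fin d) → Matrix (Fin d) (Fin q) ℝ)
    (Δ : ℝ) (x : EuclideanSpace ℝ (Fin d)) (U : ℕ → Ω → EuclideanSpace ℝ (Fin q)) :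
    ℕ → Ω → EuclideanSpace ℝ (Fin d)
  | 0, _ => x
  | i + 1, ω =>
      eulerScheme b σ Δ x U i ω
        + Δ • b (i * Δ) (eulerScheme b σ Δ x U i ω)
        + Real.sqrt Δ •
          WithLp.toLp 2 ((σ (i * Δ) (eulerScheme b σ Δ x U i ω)).mulVec (U i ω).ofLp)

/-- The numerical parameters: horizon `T`, number of steps `N`, growth exponent `α`, concentration
constant `β`, the domination constants `C_V`, `C_b`, `C_σ`, `η`, and the Lipschitz constants
`Lb = [b]₁`, `Lσ = [σ]₁`. -/
structure Params where
  T : ℝ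
  N : ℕ
  α : ℝ
  β : ℝ
  CV : ℝ
  Cb : ℝ
  Cσ : ℝ
  η : ℝ
  Lb : ℝ
  Lσ : ℝ

namespace Params

/-- Ranges of the parameters. -/
structure Valid (p : Params) : Prop where
  T_pos : 0 < p.T
  N_pos : 0 < p.N
  α_ge : 1 / 2 ≤ p.α
  α_le : p.α ≤ 1
  β_pos : 0 < p.β
  CV_pos : 0 < p.CV
  Cb_pos : 0 < p.Cb
  Cσ_pos : 0 < p.Cσ
  Lb_nonneg : 0 ≤ p.Lb
  Lσ_nonneg : 0 ≤ p.Lσ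
  Lip_pos : 0 < p.Lb + p.Lσ

variable (p : Params)

/-- The time step `Δ = T / N`. -/
def Δ : ℝ := p.T / p.N

/-- `C(Δ) = 2 [b]₁ + [σ]₁² + Δ [b]₁²`. -/
def lipConst : ℝ := 2 * p.Lb + p.Lσ ^ 2 + p.Δ * p.Lb ^ 2

/-- `φ = C_σ β (1 + C(Δ) Δ) / (4 C(Δ)) e^{3 C(Δ) T}`. -/
def φ : ℝ :=
  p.Cσ * p.β * ((1 + p.lipConst * p.Δ) / (4 * p.lipConst)) * Real.exp (3 * p.lipConst * p.T)

/-- `C = α (C_V C_b)^{1/2} + β C_σ α² (1 + 2 η Δ)² (C_V + C_b) + α η C_b Δ`. -/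
def C : ℝ :=
  p.α * Real.sqrt (p.CV * p.Cb)
    + p.β * p.Cσ * p.α ^ 2 * (1 + 2 * p.η * p.Δ) ^ 2 * (p.CV + p.Cb)
    + p.α * p.η * p.Cb * p.Δ

/-- `K = (C_V C_b)^{1/2} + η C_b Δ`. -/
def K : ℝ := Real.sqrt (p.CV * p.Cb) + p.η * p.Cb * p.Δ

/-- `ρ = (1/2) e^{-C T} min (1, ε / (2 η α C_σ T))`, the minimum being `1` if `η = 0`
(it is written as `ε / max (ε, 2 η α C_σ T)`, which is the same for `ε > 0`). -/
def rhoBar (ε : ℝ) : ℝ :=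
  1 / 2 * Real.exp (-(p.C * p.T)) * (ε / max ε (2 * p.η * p.α * p.Cσ * p.T))

section
variable {q : ℕ} (μ : Measure (EuclideanSpace ℝ (Fin q))) (ε v : ℝ)

/-- `(1/2) log E[exp (ε (1-α) / (2 α) |U|²)]`. -/
def logMoment : ℝ :=
  1 / 2 * Real.log (∫ u, Real.exp (ε * (1 - p.α) / (2 * p.α) * ‖u‖ ^ 2) ∂μ)

/-- `Ψ₁`, where `v = V(x)`. -/
def Psi1 : ℝ :=
  Real.exp ((2 * p.α - 1) / p.α * p.rhoBar ε ^ (-((1 - p.α) / (2 * p.α - 1))))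
      * Real.exp (p.rhoBar ε * ((1 - p.α) / p.α) * Real.exp (p.C * p.T) * v ^ p.α
          + p.logMoment μ ε)
    + (v ^ (1 - p.α) + (p.Cσ * (∫ u, ‖u‖ ^ 2 ∂μ) / p.K) ^ ((1 - p.α) / p.α))
      * Real.exp ((1 - p.α) * p.K * p.T)

/-- `Ψ₂`, where `v = V(x)`. -/
def Psi2 : ℝ :=
  p.rhoBar ε ^ (-((1 - p.α) / (2 * p.α - 1))) * ((2 * p.α - 1) / p.α)
    + p.rhoBar ε * ((1 - p.α) / p.α) * Real.exp (p.C * p.T) * v ^ p.α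
    + p.logMoment μ ε

/-- The multiplicative constant `Ψ = max (Ψ₁, Ψ₂) · (φ ∨ φ^{α/(2α-1)})` of the regime `α > 1/2`. -/
def Psi : ℝ :=
  max (p.Psi1 μ ε v) (p.Psi2 μ ε v) * max p.φ (p.φ ^ (p.α / (2 * p.α - 1)))

/-- `Φ_α(ρ) = Ψ (ρ² ∨ ρ^{2α/(2α-1)})`, for `α > 1/2`. -/
def Phi (ρ : ℝ≥0) : ℝ≥0∞ :=
  ENNReal.ofReal
    (p.Psi μ ε v * max ((ρ : ℝ) ^ 2) ((ρ : ℝ) ^ (2 * p.α / (2 * p.α - 1))))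

/-- The constraint on the constant `l` of the regime `α = 1/2`: `l > 0`, `l² ≤ e^{-C T}` and
`E[exp (l² 2 η α C_σ T e^{C T} |U|²)] ≤ 2`. -/
structure Admissible (l : ℝ) : Prop where
  pos : 0 < l
  sq_le : l ^ 2 ≤ Real.exp (-(p.C * p.T))
  integrable : Integrable
    (fun u => Real.exp
      (l ^ 2 * (2 * p.η * p.α * p.Cσ * p.T * Real.exp (p.C * p.T)) * ‖u‖ ^ 2)) μ
  le_two : ∫ u, Real.exp
      (l ^ 2 * (2 * p.η * p.α * p.Cσ * p.T * Real.exp (p.C * p.T)) * ‖u‖ ^ 2) ∂μ ≤ 2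

/-- `max (1, l² e^{C T} (2 V(x)^{1/2} + 2 η α C_σ E[|U|²] T))`, where `v = V(x)`. -/
def KHalf (l : ℝ) : ℝ :=
  max 1 (l ^ 2 * Real.exp (p.C * p.T)
    * (2 * Real.sqrt v + 2 * p.η * p.α * p.Cσ * (∫ u, ‖u‖ ^ 2 ∂μ) * p.T))

open scoped Classical in
/-- `Φ_{1/2}(ρ) = K r² / (1 - r)` with `r = ρ φ^{1/2} / l`, for `0 ≤ ρ < φ^{-1/2} l`;
the value `∞` elsewhere restricts the supremum in the conjugate to this domain. -/
def PhiHalf (l : ℝ) (ρ : ℝ≥0) : ℝ≥0∞ :=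
  if (ρ : ℝ) < l / Real.sqrt p.φ then
    ENNReal.ofReal (p.KHalf μ v l *
      ((ρ * Real.sqrt p.φ / l) ^ 2 / (1 - ρ * Real.sqrt p.φ / l)))
  else ∞

end

/-- `b` and `σ` are Lipschitz in space, uniformly in time, with constants `[b]₁`, `[σ]₁`. -/
structure Smooth {d q : ℕ}
    (b : ℝ → EuclideanSpace ℝ (Fin d) → EuclideanSpace ℝ (Fin d))
    (σ : ℝ → EuclideanSpace ℝ (Fin d) → Matrix (Fin d) (Fin q) ℝ) : Prop where
  b_lip : ∀ t ∈ Set.Icc 0 p.T, ∀ x y, ‖b t x - b t y‖ ≤ p.Lb * ‖x - y‖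
  σ_lip : ∀ t ∈ Set.Icc 0 p.T, ∀ x y, frobeniusNorm (σ t x - σ t y) ≤ p.Lσ * ‖x - y‖

/-- The domination assumption: `V` is a positive `C²` function with `|∇V|² ≤ C_V V` and
`sup ‖∇²V‖ ≤ 2 η`, and `|b|² ≤ C_b V`, `Tr (σ σ*) ≤ C_σ V^{1-α}` on `[0, T] × ℝᵈ`. -/
structure Dominated {d q : ℕ}
    (b : ℝ → EuclideanSpace ℝ (Fin d) → EuclideanSpace ℝ (Fin d))
    (σ : ℝ → EuclideanSpace ℝ (Fin d) → Matrix (Fin d) (Fin q) ℝ)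
    (V : EuclideanSpace ℝ (Fin d) → ℝ) : Prop where
  contDiff : ContDiff ℝ 2 V
  pos : ∀ x, 0 < V x
  grad : ∀ x, ‖gradient V x‖ ^ 2 ≤ p.CV * V x
  hess : ∀ x, ‖fderiv ℝ (fderiv ℝ V) x‖ ≤ 2 * p.η
  b_le : ∀ t ∈ Set.Icc 0 p.T, ∀ x, ‖b t x‖ ^ 2 ≤ p.Cb * V x
  σ_le : ∀ t ∈ Set.Icc 0 p.T, ∀ x,
    (σ t x * (σ t x).transpose).trace ≤ p.Cσ * V x ^ (1 - p.α)

end Params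

end EulerTE

end

open MeasureTheory ProbabilityTheory
open scoped NNReal ENNReal RealInnerProductSpace

namespace EulerTE

/-! ### Kantorovich–Rubinstein duality -/

/-! The inequality is dual to a bound on Laplace transforms. If log E exp(t (f(X) - E f(X))) ≤ Φ(t)
for every 1-Lipschitz f and every t at which Φ is finite, the entropy inequality gives t (∫ f dν - ∫
f dm) ≤ H(ν, m) + Φ(t). Kantorovich–Rubinstein duality turns this into t W₁ ≤ H + Φ(t), and the
supremum over t is Φ*(W₁) ≤ H (`monotoneConjugate_wasserstein1_le_klDiv`).

The Laplace transform of f(X_T) is bounded step by step along the Markov chain. Given the present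
position y, the next position is a function of the innovation with Lipschitz constant Δ^{1/2}
|σ(y)|, so Gaussian concentration charges each step a multiple of t² V^{1-α}(y). This charge is
unbounded unless α = 1, so exponential moments of the Lyapunov function must be carried along. They
propagate because V^α obeys an Itô-type inequality whose noise coefficient, squared, is again at
most a multiple of V^α (`rpow_eulerStep_le`, `norm_noise_coefficient_sq_le`): below level 1, the
coefficient of V^α in the exponent grows only by 1 + CΔ per step. For α ≥ 1/2 the charge V^{1-α} can
be absorbed into A + c V^α.

The induction `lintegral_eexp_map_eulerScheme_le` therefore treats E exp(t g + l V^α / 2) for all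
Lipschitz g and all small l at once. Averaging over an innovation multiplies the Lipschitz constant
of g by at most (1 + C(Δ)Δ)^{1/2}, a pure second-moment estimate, so no ellipticity is needed. The
resulting geometric sum of charges is what φ bounds.

The two regimes differ only in how φ t² V^{1-α} is absorbed. For α > 1/2, Young's inequality keeps c
fixed for large t, at the price of A growing like t^{2α/(2α-1)}. For α = 1/2 the two powers of V
coincide, c must be φ t² itself, and the bound c e^{CT} ≤ 1 confines t to a bounded interval. -/

/-- Kantorovich–Rubinstein duality on a finite set, for a cost `D` satisfying the triangle
inequality. -/
theorem exists_finite_coupling {ι : Type*} [Fintype ι] (D : ι → ι → ℝ)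
    (hD0 : ∀ i, D i i = 0) (hD : ∀ i j k, D i k ≤ D i j + D j k) (p q : ι → ℝ)
    (hp : ∀ i, 0 ≤ p i) (hq : ∀ i, 0 ≤ q i) (hp1 : ∑ i, p i = 1) (hq1 : ∑ i, q i = 1) (c : ℝ)
    (h : ∀ f : ι → ℝ, (∀ i j, f i - f j ≤ D i j) → ∑ i, f i * p i - ∑ i, f i * q i ≤ c) :
    ∃ π : ι → ι → ℝ, (∀ i j, 0 ≤ π i j) ∧ (∀ i, ∑ j, π i j = p i) ∧ (∀ j, ∑ i, π i j = q j) ∧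
      ∑ i, ∑ j, π i j * D i j ≤ c := by
  classical
  have hne : Nonempty ι := by
    by_contra hι
    rw [not_nonempty_iff] at hι
    simp at hp1
  -- A plan is sent to its two marginals and its cost. The image of the simplex is compact and
  -- convex, and a suitable plan exists exactly when it meets `B`; otherwise Hahn–Banach separation
  -- yields dual potentials that contradict `h`.
  let Λ : (ι × ι → ℝ) →ₗ[ℝ] (ι → ℝ) × (ι → ℝ) × ℝ :=
    { toFun := fun π => (fun i => ∑ j, π (i, j), fun j => ∑ i, π (i, j),
        ∑ i, ∑ j, π (i, j) * D i j)
      map_add' := by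
        intro a b
        ext <;> simp [Finset.sum_add_distrib, add_mul]
      map_smul' := by
        intro r a
        ext <;> simp [Finset.mul_sum, mul_assoc] }
  have hΛ : Continuous Λ := Λ.continuous_of_finiteDimensional
  let K := Λ '' stdSimplex ℝ (ι × ι)
  let B : Set ((ι → ℝ) × (ι → ℝ) × ℝ) := {p} ×ˢ ({q} ×ˢ Set.Iic c)
  have hKc : Convex ℝ K := (convex_stdSimplex ℝ (ι × ι)).linear_image Λ
  have hKk : IsCompact K := (isCompact_stdSimplex ℝ (ι × ι)).image hΛ
  have hBc : Convex ℝ B := (convex_singleton p).prod ((convex_singleton q).prod (convex_Iic c))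
  have hBk : IsClosed B := isClosed_singleton.prod (isClosed_singleton.prod isClosed_Iic)
  by_cases hdisj : Disjoint K B
  · exfalso
    obtain ⟨g, u, v, hgu, huv, hgv⟩ := geometric_hahn_banach_compact_closed hKc hKk hBc hBk hdisj
    set α : ι → ℝ := fun i => g (Pi.single i 1, 0, 0) with hα
    set β : ι → ℝ := fun i => g (0, Pi.single i 1, 0) with hβ
    set γ : ℝ := g (0, 0, 1) with hγ
    have hg : ∀ (a b : ι → ℝ) (r : ℝ),
        g (a, b, r) = ∑ i, α i * a i + ∑ i, β i * b i + γ * r := by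
      intro a b r
      have e1 : ((a, b, r) : (ι → ℝ) × (ι → ℝ) × ℝ) = (∑ i, a i • (Pi.single i (1 : ℝ), 0, 0))
          + (∑ i, b i • (0, Pi.single i (1 : ℝ), 0)) + r • (0, 0, 1) := by
        ext k
        · simp [Prod.fst_sum, Finset.sum_apply, Pi.single_apply]
        · simp [Prod.fst_sum, Prod.snd_sum, Finset.sum_apply, Pi.single_apply]
        · simp [Prod.snd_sum]
      rw [e1, map_add, map_add, map_sum, map_sum, map_smul]
      simp only [map_smul, smul_eq_mul, hα, hβ, hγ]
      congr 1
      · congr 1 <;> exact Finset.sum_congr rfl fun i _ => mul_comm _ _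
      · ring
    have hvert : ∀ i j, α i + β j + γ * D i j < u := by
      intro i j
      have := hgu _ ⟨Pi.single (i, j) 1, single_mem_stdSimplex ℝ (i, j), rfl⟩
      have e : Λ (Pi.single (i, j) 1) = (Pi.single i 1, Pi.single j 1, D i j) := by
        ext k
        · by_cases hk : k = i <;> simp [Λ, Pi.single_apply, hk]
          exact Finset.card_eq_one.mpr ⟨j, by ext; simp⟩
        · by_cases hk : k = j <;> simp [Λ, Pi.single_apply, hk]
          exact Finset.card_eq_one.mpr ⟨i, by ext; simp⟩
        · simp [Λ, Pi.single_apply, Prod.ext_iff, ite_and]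
      rw [e, hg] at this
      simpa [Pi.single_apply] using this
    have hB : ∀ r ≤ c, v < ∑ i, α i * p i + ∑ i, β i * q i + γ * r := by
      intro r hr
      rw [← hg]
      exact hgv _ ⟨rfl, rfl, hr⟩
    -- A positive `γ` is excluded by letting the cost coordinate go to -∞ inside `B`. If `γ = 0`,
    -- averaging the vertex inequalities against the product plan p ⊗ q contradicts the separation.
    have hγ0 : γ < 0 := by
      have hle : γ ≤ 0 := by
        by_contra hpos
        push Not at hpos
        set M := ∑ i, α i * p i + ∑ i, β i * q i with hM
        have := hB (min c ((v - M) / γ)) (min_le_left _ _)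
        have h2 : γ * min c ((v - M) / γ) ≤ γ * ((v - M) / γ) :=
          mul_le_mul_of_nonneg_left (min_le_right _ _) hpos.le
        rw [mul_div_cancel₀ _ hpos.ne'] at h2
        linarith
      refine lt_of_le_of_ne hle fun h0 => ?_
      have h1 := hB c le_rfl
      simp only [h0, zero_mul, add_zero] at h1 hvert
      have h2 : ∑ i, ∑ j, p i * q j * (α i + β j) ≤ ∑ i, ∑ j, p i * q j * u :=
        Finset.sum_le_sum fun i _ => Finset.sum_le_sum fun j _ =>
          mul_le_mul_of_nonneg_left (hvert i j).le (mul_nonneg (hp i) (hq j))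
      have e1 : ∑ i, ∑ j, p i * q j * u = u := by
        simp_rw [← Finset.sum_mul, ← Finset.mul_sum, hq1, mul_one, hp1, one_mul]
      have e2 : ∑ i, ∑ j, p i * q j * (α i + β j) = ∑ i, α i * p i + ∑ i, β i * q i := by
        have : ∀ i j, p i * q j * (α i + β j) = (α i * p i) * q j + p i * (β j * q j) := by
          intros; ring
        simp_rw [this, Finset.sum_add_distrib, ← Finset.mul_sum, hq1, mul_one,
          ← Finset.sum_mul, hp1, one_mul]
      linarith
    set a : ι → ℝ := fun i => α i / (-γ) with ha
    set b : ι → ℝ := fun j => (β j - u) / (-γ) with hb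
    have hγ' : 0 < -γ := by linarith
    have hab : ∀ i j, a i + b j ≤ D i j := by
      intro i j
      rw [ha, hb, ← add_div, div_le_iff₀ hγ']
      linarith [hvert i j]
    -- The c-transform merges the two potentials into one: a ≤ f because a + b ≤ D, f ≤ -b because D
    -- vanishes on the diagonal, and the triangle inequality makes f admissible in `h`.
    let f : ι → ℝ := fun i => Finset.univ.inf' Finset.univ_nonempty fun j => D i j - b j
    have hfa : ∀ i, a i ≤ f i := fun i =>
      Finset.le_inf' _ _ fun j _ => by linarith [hab i j]
    have hfb : ∀ i, f i ≤ - b i := fun i => by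
      have := Finset.inf'_le (fun j => D i j - b j) (Finset.mem_univ i)
      simpa [hD0] using this
    have hfD : ∀ i j, f i - f j ≤ D i j := by
      intro i j
      have : f i - D i j ≤ f j := Finset.le_inf' _ _ fun k _ => by
        have := Finset.inf'_le (fun j => D i j - b j) (Finset.mem_univ k)
        have h3 := hD i j k
        change f i ≤ _ at this
        linarith
      linarith
    have hc := h f hfD
    have h1 : ∑ i, a i * p i ≤ ∑ i, f i * p i :=
      Finset.sum_le_sum fun i _ => mul_le_mul_of_nonneg_right (hfa i) (hp i)
    have h2 : ∑ i, f i * q i ≤ ∑ i, (- b i) * q i :=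
      Finset.sum_le_sum fun i _ => mul_le_mul_of_nonneg_right (hfb i) (hq i)
    have h3 := hB c le_rfl
    have e1 : ∑ i, a i * p i = (∑ i, α i * p i) / (-γ) := by
      rw [Finset.sum_div]; exact Finset.sum_congr rfl fun i _ => by rw [ha]; ring
    have e2 : ∑ i, (- b i) * q i = (u - ∑ i, β i * q i) / (-γ) := by
      have : ∀ i, (- b i) * q i = (u * q i - β i * q i) / (-γ) := by intro i; rw [hb]; ring
      simp_rw [this]
      rw [← Finset.sum_div, Finset.sum_sub_distrib, ← Finset.mul_sum, hq1, mul_one]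
    have h4 : (∑ i, α i * p i) / (-γ) - (u - ∑ i, β i * q i) / (-γ) ≤ c := by linarith
    rw [← sub_div, div_le_iff₀ hγ'] at h4
    linarith
  · rw [Set.not_disjoint_iff] at hdisj
    obtain ⟨_, ⟨π, hπ, rfl⟩, h1, h2, h3⟩ := hdisj
    exact ⟨fun i j => π (i, j), fun i j => hπ.1 _, fun i => congrFun h1 i,
      fun j => congrFun h2 j, h3⟩

/-- Two measures can be coupled along a coupling of their images under a simple function. -/
theorem exists_coupling_of_simpleFunc {E : Type*} [MeasurableSpace E]
    (ν m : Measure E) [IsProbabilityMeasure ν] [IsProbabilityMeasure m] (S : SimpleFunc E E)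
    (π : S.range → S.range → ℝ) (hπ0 : ∀ i j, 0 ≤ π i j)
    (hπ1 : ∀ i, ∑ j, π i j = ν.real (S ⁻¹' {i.1})) (hπ2 : ∀ j, ∑ i, π i j = m.real (S ⁻¹' {j.1})) :
    ∃ Γ : Measure (E × E), Γ.map Prod.fst = ν ∧ Γ.map Prod.snd = m ∧
      ∀ F : E → E → ℝ≥0∞, ∫⁻ z, F (S z.1) (S z.2) ∂Γ
        = ∑ i, ∑ j, ENNReal.ofReal (π i j) * F i.1 j.1 := by
  classical
  let A : S.range → Set E := fun i => S ⁻¹' {i.1}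
  have hA : ∀ i, MeasurableSet (A i) := fun i => S.measurableSet_fiber _
  have hAd : Pairwise (Function.onFun Disjoint A) := by
    intro i j hij
    rw [Function.onFun, Set.disjoint_left]
    intro x hx hx'
    exact hij (Subtype.ext (hx.symm.trans hx'))
  have hAu : ⋃ i, A i = Set.univ := by
    ext x
    simp only [Set.mem_iUnion, Set.mem_univ, iff_true]
    exact ⟨⟨S x, S.mem_range_self x⟩, rfl⟩
  have hsum : ∀ (κ : Measure E), ∑ i, κ.restrict (A i) = κ := by
    intro κ
    have := Measure.restrict_iUnion hAd hA (μ := κ)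
    rw [hAu, Measure.restrict_univ, Measure.sum_fintype] at this
    exact this.symm
  -- Inside each pair of cells the mass π i j is spread as a normalised product measure. On a null
  -- cell the inverse is ∞, but π i j is then 0 and the convention 0 * ∞ = 0 gives weight 0.
  let w : S.range → S.range → ℝ≥0∞ := fun i j => ENNReal.ofReal (π i j) * (ν (A i))⁻¹ * (m (A j))⁻¹
  let Γ : Measure (E × E) := ∑ i, ∑ j, w i j • (ν.restrict (A i)).prod (m.restrict (A j))
  have s1 : ∀ i, ∑ j, ENNReal.ofReal (π i j) = ν (A i) := by
    intro i
    rw [← ENNReal.ofReal_sum_of_nonneg fun j _ => hπ0 i j, hπ1, ofReal_measureReal]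
  have s2 : ∀ j, ∑ i, ENNReal.ofReal (π i j) = m (A j) := by
    intro j
    rw [← ENNReal.ofReal_sum_of_nonneg fun i _ => hπ0 i j, hπ2, ofReal_measureReal]
  have z1 : ∀ i j, ν (A i) = 0 → ENNReal.ofReal (π i j) = 0 := by
    intro i j h
    rw [← s1 i] at h
    exact (Finset.sum_eq_zero_iff.mp h) j (Finset.mem_univ j)
  have z2 : ∀ i j, m (A j) = 0 → ENNReal.ofReal (π i j) = 0 := by
    intro i j h
    rw [← s2 j] at h
    exact (Finset.sum_eq_zero_iff.mp h) i (Finset.mem_univ i)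
  have w1 : ∀ i j, w i j * m (A j) = ENNReal.ofReal (π i j) * (ν (A i))⁻¹ := by
    intro i j
    by_cases h : m (A j) = 0
    · simp [w, z2 i j h]
    · simp only [w]
      rw [mul_assoc, ENNReal.inv_mul_cancel h (measure_ne_top _ _), mul_one]
  have w2 : ∀ i j, w i j * ν (A i) = ENNReal.ofReal (π i j) * (m (A j))⁻¹ := by
    intro i j
    by_cases h : ν (A i) = 0
    · simp [w, z1 i j h]
    · simp only [w]
      rw [mul_right_comm, mul_assoc (ENNReal.ofReal _),
        ENNReal.inv_mul_cancel h (measure_ne_top _ _), mul_one]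
  have w3 : ∀ i j, w i j * (ν (A i) * m (A j)) = ENNReal.ofReal (π i j) := by
    intro i j
    by_cases h : ν (A i) = 0
    · simp [w, z1 i j h]
    · rw [mul_comm (ν _), ← mul_assoc, w1, mul_assoc,
        ENNReal.inv_mul_cancel h (measure_ne_top _ _), mul_one]
  refine ⟨Γ, ?_, ?_, ?_⟩
  · conv_rhs => rw [← hsum ν]
    ext s hs
    rw [Measure.map_apply measurable_fst hs]
    simp only [Γ, Measure.coe_finsetSum, Finset.sum_apply, Measure.smul_apply, smul_eq_mul]
    refine Finset.sum_congr rfl fun i _ => ?_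
    have : ∀ j, ((ν.restrict (A i)).prod (m.restrict (A j))) (Prod.fst ⁻¹' s)
        = m (A j) * ν.restrict (A i) s := by
      intro j
      rw [← Set.prod_univ, Measure.prod_prod, Measure.restrict_apply_univ, mul_comm]
    simp_rw [this, ← mul_assoc, w1, ← Finset.sum_mul, s1]
    by_cases h : ν (A i) = 0
    · rw [h, Measure.restrict_eq_zero.mpr h]; simp
    · rw [ENNReal.mul_inv_cancel h (measure_ne_top _ _), one_mul]
  · conv_rhs => rw [← hsum m]
    ext s hs
    rw [Measure.map_apply measurable_snd hs]
    simp only [Γ, Measure.coe_finsetSum, Finset.sum_apply, Measure.smul_apply, smul_eq_mul]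
    rw [Finset.sum_comm]
    refine Finset.sum_congr rfl fun j _ => ?_
    have : ∀ i, ((ν.restrict (A i)).prod (m.restrict (A j))) (Prod.snd ⁻¹' s)
        = ν (A i) * m.restrict (A j) s := by
      intro i
      rw [← Set.univ_prod, Measure.prod_prod, Measure.restrict_apply_univ]
    simp_rw [this, ← mul_assoc, w2, ← Finset.sum_mul, s2]
    by_cases h : m (A j) = 0
    · rw [h, Measure.restrict_eq_zero.mpr h]; simp
    · rw [ENNReal.mul_inv_cancel h (measure_ne_top _ _), one_mul]
  · intro F
    simp only [Γ, lintegral_finsetSum_measure, lintegral_smul_measure, smul_eq_mul]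
    refine Finset.sum_congr rfl fun i _ => Finset.sum_congr rfl fun j _ => ?_
    have : ∫⁻ z, F (S z.1) (S z.2) ∂((ν.restrict (A i)).prod (m.restrict (A j)))
        = ν (A i) * m (A j) * F i.1 j.1 := by
      rw [Measure.prod_restrict, setLIntegral_congr_fun (g := fun _ => F i.1 j.1)
        ((hA i).prod (hA j)), setLIntegral_const, Measure.prod_prod, mul_comm]
      rintro ⟨y, z⟩ ⟨hy, hz⟩
      have hy' : S y = i.1 := hy
      have hz' : S z = j.1 := hz
      simp [hy', hz']
    rw [this, ← mul_assoc, w3]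

theorem integral_comp_simpleFunc {E : Type*} [MeasurableSpace E] (ν : Measure E)
    [IsFiniteMeasure ν] (S : SimpleFunc E E) (g : E → ℝ) :
    ∫ y, g (S y) ∂ν = ∑ i : S.range, g i * ν.real (S ⁻¹' {i.1}) := by
  classical
  have h : ∀ y, g (S y) = ∑ i : S.range, (S ⁻¹' {i.1}).indicator (fun _ => g i) y := by
    intro y
    rw [Finset.sum_eq_single ⟨S y, S.mem_range_self y⟩]
    · simp
    · intro j _ hj
      refine Set.indicator_of_notMem (fun hy => hj (Subtype.ext ?_)) _
      exact (show S y = j.1 from hy).symm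
    · simp
  simp_rw [h]
  rw [integral_finsetSum]
  · refine Finset.sum_congr rfl fun i _ => ?_
    rw [integral_indicator_const _ (S.measurableSet_fiber _), smul_eq_mul, mul_comm]
  · intro i _
    exact (integrable_const _).indicator (S.measurableSet_fiber _)

/-- Integrable measures are close in transport cost to their images under simple functions. -/
theorem exists_simpleFunc_edist_le {n : ℕ} (κ : Measure (EuclideanSpace ℝ (Fin n)))
    (hκ : Integrable (fun y => ‖y‖) κ) (δ : ℝ≥0) (hδ : 0 < δ) :
    ∃ S : SimpleFunc (EuclideanSpace ℝ (Fin n)) (EuclideanSpace ℝ (Fin n)),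
      ∫⁻ y, edist (S y) y ∂κ ≤ δ := by
  have hi : HasFiniteIntegral (fun y : EuclideanSpace ℝ (Fin n) => id y - 0) κ := by
    have := hκ.hasFiniteIntegral
    simpa [HasFiniteIntegral] using this
  have := SimpleFunc.tendsto_approxOn_L1_enorm (f := id) measurable_id (Set.mem_univ 0)
    (μ := κ) (by simp) hi
  have h2 := this.eventually (Iic_mem_nhds (ENNReal.coe_pos.mpr hδ))
  obtain ⟨k, hk⟩ := h2.exists
  exact ⟨_, by simpa only [edist_eq_enorm_sub, id] using hk⟩

theorem abs_le_add_norm_of_lipschitzWith {F : Type*} [SeminormedAddCommGroup F] {g : F → ℝ}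
    (hg : LipschitzWith 1 g) (y : F) : |g y| ≤ |g 0| + ‖y‖ := by
  have := hg.dist_le_mul y 0
  rw [Real.dist_eq, dist_zero_right, NNReal.coe_one, one_mul] at this
  calc |g y| = |g 0 + (g y - g 0)| := by ring_nf
    _ ≤ |g 0| + |g y - g 0| := abs_add_le _ _
    _ ≤ |g 0| + ‖y‖ := by linarith

/-- **Kantorovich–Rubinstein duality** (the nontrivial inequality). -/
theorem wasserstein1_le_of_forall_lipschitz {n : ℕ}
    (ν m : Measure (EuclideanSpace ℝ (Fin n))) [IsProbabilityMeasure ν] [IsProbabilityMeasure m]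
    (hν : Integrable (fun y => ‖y‖) ν) (hm : Integrable (fun y => ‖y‖) m) (c : ℝ)
    (h : ∀ f : EuclideanSpace ℝ (Fin n) → ℝ, LipschitzWith 1 f →
      ∫ y, f y ∂ν - ∫ y, f y ∂m ≤ c) :
    wasserstein1 ν m ≤ ENNReal.ofReal c := by
  refine ENNReal.le_of_forall_pos_le_add fun ε hε _ => ?_
  have hδ : 0 < ε / 2 := half_pos hε
  -- Discretising for ν + m gives one simple function good for both measures. The total error ε/2 is
  -- paid twice: in comparing integrals of test functions, and in moving the finite coupling back to
  -- ν and m.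
  obtain ⟨S, hS⟩ := exists_simpleFunc_edist_le (ν + m) (hν.add_measure hm) (ε / 2) hδ
  rw [lintegral_add_measure] at hS
  have hdist : ∀ κ : Measure (EuclideanSpace ℝ (Fin n)),
      ∫⁻ y, edist (S y) y ∂κ ≠ ∞ → Integrable (fun y => dist (S y) y) κ ∧
        ∫⁻ y, edist (S y) y ∂κ = ENNReal.ofReal (∫ y, dist (S y) y ∂κ) := by
    intro κ hκ
    have hme : Measurable fun y => dist (S y) y := S.measurable.dist measurable_id
    have hint : Integrable (fun y => dist (S y) y) κ := by
      refine ⟨hme.aestronglyMeasurable, ?_⟩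
      rw [hasFiniteIntegral_iff_ofReal (by filter_upwards with y using dist_nonneg)]
      simpa only [edist_dist, lt_top_iff_ne_top] using hκ
    refine ⟨hint, ?_⟩
    rw [ofReal_integral_eq_lintegral_ofReal hint (by filter_upwards with y using dist_nonneg)]
    simp only [edist_dist]
  have hfin : ∫⁻ y, edist (S y) y ∂ν + ∫⁻ y, edist (S y) y ∂m ≠ ∞ :=
    ne_top_of_le_ne_top ENNReal.coe_ne_top hS
  obtain ⟨iν, eν⟩ := hdist ν (ENNReal.add_ne_top.mp hfin).1
  obtain ⟨im, em⟩ := hdist m (ENNReal.add_ne_top.mp hfin).2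
  have nν : 0 ≤ ∫ y, dist (S y) y ∂ν := integral_nonneg fun _ => dist_nonneg
  have nm : 0 ≤ ∫ y, dist (S y) y ∂m := integral_nonneg fun _ => dist_nonneg
  have hreal : ∫ y, dist (S y) y ∂ν + ∫ y, dist (S y) y ∂m ≤ (ε / 2 : ℝ≥0) := by
    rw [eν, em, ← ENNReal.ofReal_add nν nm] at hS
    rw [← ENNReal.ofReal_coe_nnreal] at hS
    exact (ENNReal.ofReal_le_ofReal_iff (by positivity)).mp hS
  have hgap : ∀ (κ : Measure (EuclideanSpace ℝ (Fin n))) [IsProbabilityMeasure κ]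
      (g : EuclideanSpace ℝ (Fin n) → ℝ), Integrable (fun y => ‖y‖) κ →
      Integrable (fun y => dist (S y) y) κ → LipschitzWith 1 g →
      |∫ y, g (S y) ∂κ - ∫ y, g y ∂κ| ≤ ∫ y, dist (S y) y ∂κ := by
    intro κ _ g hκ hd hg
    have hgi : Integrable g κ := by
      refine ((integrable_const |g 0|).add hκ).mono' hg.continuous.aestronglyMeasurable ?_
      filter_upwards with y using abs_le_add_norm_of_lipschitzWith hg y
    have hgS : Integrable (fun y => g (S y)) κ := (S.map g).integrable_of_isFiniteMeasure
    rw [← integral_sub hgS hgi]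
    refine abs_integral_le_integral_abs.trans (integral_mono (hgS.sub hgi).abs hd fun y => ?_)
    have := hg.dist_le_mul (S y) y
    rwa [Real.dist_eq, NNReal.coe_one, one_mul] at this
  have hsum1 : ∀ (κ : Measure (EuclideanSpace ℝ (Fin n))) [IsProbabilityMeasure κ],
      ∑ i : S.range, κ.real (S ⁻¹' {i.1}) = 1 := by
    intro κ _
    have := integral_comp_simpleFunc κ S (fun _ => 1)
    simpa using this.symm
  obtain ⟨π, hπ0, hπ1, hπ2, hπc⟩ := exists_finite_coupling
    (fun i j : S.range => dist i.1 j.1) (fun i => dist_self _)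
    (fun i j k => dist_triangle _ _ _) (fun i => ν.real (S ⁻¹' {i.1}))
    (fun i => m.real (S ⁻¹' {i.1})) (fun i => measureReal_nonneg) (fun i => measureReal_nonneg)
    (hsum1 ν) (hsum1 m) (c + (ε / 2 : ℝ≥0)) (by
      intro f hf
      let f' : EuclideanSpace ℝ (Fin n) → ℝ := Function.extend Subtype.val f 0
      have hf' : ∀ i : S.range, f' i = f i := fun i =>
        Subtype.val_injective.extend_apply f 0 i
      have hl : LipschitzOnWith 1 f' (S.range : Set (EuclideanSpace ℝ (Fin n))) := by
        refine LipschitzOnWith.of_dist_le_mul fun y hy z hz => ?_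
        have e1 : f' y = f ⟨y, hy⟩ := hf' ⟨y, hy⟩
        have e2 : f' z = f ⟨z, hz⟩ := hf' ⟨z, hz⟩
        rw [e1, e2, Real.dist_eq, NNReal.coe_one, one_mul, abs_le]
        have a1 := hf ⟨y, hy⟩ ⟨z, hz⟩
        have a2 := hf ⟨z, hz⟩ ⟨y, hy⟩
        rw [dist_comm] at a2
        constructor <;> simp only at a1 a2 <;> linarith
      -- McShane extension: a test function on the finite range becomes 1-Lipschitz on the whole
      -- space, so `h` applies to it.
      obtain ⟨g, hg, hgf⟩ := hl.extend_real
      have hgi : ∀ i : S.range, f i = g i := fun i => by rw [← hf' i, hgf i.2]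
      simp_rw [hgi]
      rw [← integral_comp_simpleFunc, ← integral_comp_simpleFunc]
      have b1 := (abs_le.mp (hgap ν g hν iν hg)).2
      have b2 := (abs_le.mp (hgap m g hm im hg)).1
      linarith [h g hg])
  obtain ⟨Γ, hΓ1, hΓ2, hΓ⟩ := exists_coupling_of_simpleFunc ν m S π hπ0 hπ1 hπ2
  have hΓp : IsProbabilityMeasure Γ := by
    constructor
    rw [← Set.preimage_univ (f := Prod.fst), ← Measure.map_apply measurable_fst .univ, hΓ1]
    exact measure_univ
  have hcost : ∫⁻ z, edist z.1 z.2 ∂Γ ≤ ENNReal.ofReal c + ε := by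
    have hmeas : Measurable fun y => edist (S y) y := S.measurable.edist measurable_id
    calc ∫⁻ z, edist z.1 z.2 ∂Γ
        ≤ ∫⁻ z, (edist (S z.1) z.1 + edist (S z.2) z.2) + edist (S z.1) (S z.2) ∂Γ := by
          refine lintegral_mono fun z => ?_
          calc edist z.1 z.2 ≤ edist z.1 (S z.1) + edist (S z.1) (S z.2) + edist (S z.2) z.2 :=
                edist_triangle4 _ _ _ _
            _ = _ := by rw [edist_comm z.1]; ring
      _ = (∫⁻ y, edist (S y) y ∂ν + ∫⁻ y, edist (S y) y ∂m)
            + ∫⁻ z, edist (S z.1) (S z.2) ∂Γ := by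
          have m1 : Measurable fun z : EuclideanSpace ℝ (Fin n) × EuclideanSpace ℝ (Fin n) =>
            edist (S z.1) z.1 := hmeas.comp measurable_fst
          have m2 : Measurable fun z : EuclideanSpace ℝ (Fin n) × EuclideanSpace ℝ (Fin n) =>
            edist (S z.1) z.1 + edist (S z.2) z.2 := m1.add (hmeas.comp measurable_snd)
          rw [lintegral_add_left m2, lintegral_add_left m1, ← hΓ1, ← hΓ2,
            lintegral_map hmeas measurable_fst, lintegral_map hmeas measurable_snd]
      _ ≤ (ε / 2 : ℝ≥0) + (ENNReal.ofReal c + (ε / 2 : ℝ≥0)) := by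
          refine add_le_add hS ?_
          rw [hΓ fun y z => edist y z]
          have : ∑ i : S.range, ∑ j : S.range, ENNReal.ofReal (π i j) * edist i.1 j.1
              = ENNReal.ofReal (∑ i, ∑ j, π i j * dist i.1 j.1) := by
            rw [ENNReal.ofReal_sum_of_nonneg fun i _ => Finset.sum_nonneg fun j _ =>
              mul_nonneg (hπ0 i j) dist_nonneg]
            refine Finset.sum_congr rfl fun i _ => ?_
            rw [ENNReal.ofReal_sum_of_nonneg fun j _ => mul_nonneg (hπ0 i j) dist_nonneg]
            refine Finset.sum_congr rfl fun j _ => ?_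
            rw [ENNReal.ofReal_mul (hπ0 i j), edist_dist]
          rw [this]
          refine (ENNReal.ofReal_le_ofReal hπc).trans (ENNReal.ofReal_add_le.trans ?_)
          rw [ENNReal.ofReal_coe_nnreal]
      _ = ENNReal.ofReal c + ε := by
          rw [add_left_comm, ← ENNReal.coe_add, add_halves]
  refine le_trans ?_ hcost
  exact iInf_le_of_le Γ (iInf_le_of_le hΓp (iInf_le_of_le hΓ1 (iInf_le _ hΓ2)))

/-! ### From exponential moments of Lipschitz functions to transport-entropy inequalities -/

/-- Fenchel–Young inequality for the dual pair x log x - x and e^s; with x a density, integrating it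
gives both entropy inequalities below. -/
theorem mul_le_klFun_add_exp_sub_one {x : ℝ} (hx : 0 ≤ x) (s : ℝ) :
    x * s ≤ InformationTheory.klFun x + (Real.exp s - 1) := by
  rw [InformationTheory.klFun_apply]
  rcases hx.eq_or_lt with rfl | hx
  · simp [(Real.exp_pos s).le]
  · have h := Real.add_one_le_exp (s - Real.log x)
    rw [Real.exp_sub, Real.exp_log hx] at h
    have h2 := mul_le_mul_of_nonneg_left h hx.le
    rw [mul_div_cancel₀ _ hx.ne'] at h2
    nlinarith

/-- Entropy inequality for nonnegative functions. -/
theorem lintegral_le_klDiv_add {E : Type*} [MeasurableSpace E] (ν m : Measure E)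
    [IsProbabilityMeasure ν] [IsProbabilityMeasure m] (hac : ν ≪ m)
    (s : E → ℝ) (hs : Measurable s) :
    ∫⁻ y, ENNReal.ofReal (s y) ∂ν
      ≤ InformationTheory.klDiv ν m + ∫⁻ y, ENNReal.ofReal (Real.exp (s y)) ∂m := by
  rw [InformationTheory.klDiv_eq_lintegral_klFun_of_ac hac,
    ← lintegral_rnDeriv_mul hac hs.ennreal_ofReal.aemeasurable,
    ← lintegral_add_right _ (by fun_prop)]
  refine lintegral_mono_ae ?_
  filter_upwards [ν.rnDeriv_ne_top m] with y hy
  have h0 : (0 : ℝ) ≤ (ν.rnDeriv m y).toReal := ENNReal.toReal_nonneg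
  conv_lhs => rw [← ENNReal.ofReal_toReal hy]
  rw [← ENNReal.ofReal_mul h0, ← ENNReal.ofReal_add (InformationTheory.klFun_nonneg h0)
    (Real.exp_pos _).le]
  exact ENNReal.ofReal_le_ofReal (by linarith [mul_le_klFun_add_exp_sub_one h0 (s y)])

/-- Entropy inequality: `∫ s dν ≤ H(ν, m)` as soon as `∫ e^s dm ≤ 1`. -/
theorem integral_le_toReal_klDiv {E : Type*} [MeasurableSpace E] (ν m : Measure E)
    [IsProbabilityMeasure ν] [IsProbabilityMeasure m]
    (hkl : InformationTheory.klDiv ν m ≠ ∞) (s : E → ℝ)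
    (hsν : Integrable s ν) (hexp : Integrable (fun y => Real.exp (s y)) m)
    (h1 : ∫ y, Real.exp (s y) ∂m ≤ 1) :
    ∫ y, s y ∂ν ≤ (InformationTheory.klDiv ν m).toReal := by
  obtain ⟨hac, hllr⟩ := InformationTheory.klDiv_ne_top_iff.mp hkl
  rw [InformationTheory.toReal_klDiv_eq_integral_klFun hac, ← integral_toReal_rnDeriv_mul hac]
  have hi := (InformationTheory.integrable_klFun_rnDeriv_iff hac).mpr hllr
  have hi2 : Integrable (fun y => (ν.rnDeriv m y).toReal * s y) m :=
    (integrable_rnDeriv_smul_iff hac).mpr hsν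
  have hi3 : Integrable (fun y => Real.exp (s y) - 1) m := hexp.sub (integrable_const _)
  have := integral_mono hi2 (hi.add hi3) fun y =>
    mul_le_klFun_add_exp_sub_one (ENNReal.toReal_nonneg (a := ν.rnDeriv m y)) (s y)
  simp only [Pi.add_apply] at this
  rw [integral_add hi hi3, integral_sub hexp (integrable_const _)] at this
  simp at this
  linarith

/-- If the logarithmic Laplace transforms of all centred `1`-Lipschitz functions are dominated by
`Φ`, then `Φ*(W₁) ≤ H`. -/
theorem monotoneConjugate_wasserstein1_le_klDiv {n : ℕ} (m : Measure (EuclideanSpace ℝ (Fin n)))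
    [IsProbabilityMeasure m] (Φ : ℝ≥0 → ℝ≥0∞)
    (hm : Integrable (fun y => ‖y‖) m)
    (hfin : ∃ t : ℝ≥0, 0 < t ∧ Φ t ≠ ∞)
    (h : ∀ f : EuclideanSpace ℝ (Fin n) → ℝ, LipschitzWith 1 f → ∀ t : ℝ≥0, 0 < t → Φ t ≠ ∞ →
      Integrable (fun y => Real.exp (t * f y)) m ∧
      ∫ y, Real.exp (t * f y) ∂m ≤ Real.exp (t * ∫ y, f y ∂m + (Φ t).toReal))
    (ν : Measure (EuclideanSpace ℝ (Fin n))) [IsProbabilityMeasure ν] :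
    monotoneConjugate Φ (wasserstein1 ν m) ≤ InformationTheory.klDiv ν m := by
  by_cases hkl : InformationTheory.klDiv ν m = ∞
  · rw [hkl]; exact le_top
  have hac := (InformationTheory.klDiv_ne_top_iff.mp hkl).1
  -- Finite entropy forces a first moment on ν, because the norm is itself 1-Lipschitz and so has an
  -- exponential moment under m.
  have hν : Integrable (fun y => ‖y‖) ν := by
    obtain ⟨t, ht0, ht⟩ := hfin
    have hti := (h (fun y => ‖y‖) lipschitzWith_one_norm t ht0 ht).1
    have h1 := lintegral_le_klDiv_add ν m hac (fun y => t * ‖y‖) (by fun_prop)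
    have h2 : Integrable (fun y => t * ‖y‖) ν := by
      refine ⟨by fun_prop, ?_⟩
      rw [hasFiniteIntegral_iff_ofReal (by filter_upwards with y using by positivity)]
      refine h1.trans_lt (ENNReal.add_lt_top.mpr ⟨lt_top_iff_ne_top.mpr hkl, ?_⟩)
      have h3 := hti.hasFiniteIntegral
      rwa [hasFiniteIntegral_iff_ofReal
        (by filter_upwards with y using (Real.exp_pos _).le)] at h3
    simpa [← mul_assoc, inv_mul_cancel₀ (NNReal.coe_pos.mpr ht0).ne'] using h2.const_mul (t : ℝ)⁻¹
  refine iSup_le fun t => ?_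
  rw [tsub_le_iff_right]
  by_cases hΦ : Φ t = ∞
  · simp [hΦ]
  rcases eq_zero_or_pos t with rfl | ht
  · simp
  have ht' : (0 : ℝ) < t := ht
  set c := ((InformationTheory.klDiv ν m).toReal + (Φ t).toReal) / t with hc
  have hW : wasserstein1 ν m ≤ ENNReal.ofReal c := by
    refine wasserstein1_le_of_forall_lipschitz ν m hν hm c fun f hf => ?_
    obtain ⟨hi, hle⟩ := h f hf t ht hΦ
    have hfν : Integrable f ν :=
      ((integrable_const |f 0|).add hν).mono' hf.continuous.aestronglyMeasurable
        (by filter_upwards with y using abs_le_add_norm_of_lipschitzWith hf y)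
    -- Subtracting `a` normalises the exponential to have integral at most 1 under m, as the entropy
    -- inequality requires.
    set a := t * ∫ y, f y ∂m + (Φ t).toReal with ha
    have e : ∀ y, Real.exp (t * f y - a) = Real.exp (t * f y) * Real.exp (-a) := by
      intro y; rw [← Real.exp_add, sub_eq_add_neg]
    have hk := integral_le_toReal_klDiv ν m hkl (fun y => t * f y - a)
      ((hfν.const_mul _).sub (integrable_const _)) (by simp_rw [e]; exact hi.mul_const _) (by
        simp_rw [e]
        rw [integral_mul_const]
        calc _ ≤ Real.exp a * Real.exp (-a) := by gcongr
          _ = 1 := by rw [← Real.exp_add]; simp)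
    rw [integral_sub (hfν.const_mul _) (integrable_const _), integral_const_mul] at hk
    simp only [integral_const, probReal_univ, one_smul] at hk
    rw [hc, le_div_iff₀ ht']
    linarith
  calc wasserstein1 ν m * t ≤ ENNReal.ofReal c * t := by gcongr
    _ = ENNReal.ofReal ((InformationTheory.klDiv ν m).toReal + (Φ t).toReal) := by
      rw [← ENNReal.ofReal_coe_nnreal, ← ENNReal.ofReal_mul (by positivity), hc,
        div_mul_cancel₀ _ ht'.ne']
    _ = _ := by
      rw [ENNReal.ofReal_add ENNReal.toReal_nonneg ENNReal.toReal_nonneg,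
        ENNReal.ofReal_toReal hkl, ENNReal.ofReal_toReal hΦ]

/-! ### Conjugates as transport functions -/

/-- Convexity is that of a supremum of truncated affine functions. Strict monotonicity then follows
from convexity, vanishing at 0 and positivity elsewhere: Φ*(v) ≤ (v/w) Φ*(w) < Φ*(w) for v < w. -/
theorem isTransportFunction_monotoneConjugate (Φ : ℝ≥0 → ℝ≥0∞)
    (hfin : ∀ w : ℝ≥0, monotoneConjugate Φ w ≠ ∞)
    (hpos : ∀ w : ℝ≥0, 0 < w → ∃ ρ, Φ ρ < w * ρ) :
    IsTransportFunction (monotoneConjugate Φ) := by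
  have hzero : monotoneConjugate Φ 0 = 0 := by simp [monotoneConjugate]
  have hconv : ConvexOn ℝ≥0 Set.univ (fun w : ℝ≥0 => monotoneConjugate Φ w) := by
    refine ⟨convex_univ, fun v _ w _ a b _ _ hab => iSup_le fun ρ => ?_⟩
    rw [tsub_le_iff_right]
    have hab' : (a : ℝ≥0∞) + b = 1 := by rw [← ENNReal.coe_add, hab]; rfl
    have h : ∀ z : ℝ≥0, (z : ℝ≥0∞) * ρ ≤ monotoneConjugate Φ z + Φ ρ := fun z =>
      tsub_le_iff_right.mp (le_iSup (fun ρ : ℝ≥0 => (z : ℝ≥0∞) * ρ - Φ ρ) ρ)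
    simp only [ENNReal.smul_def, smul_eq_mul, ENNReal.coe_add, ENNReal.coe_mul]
    calc ((a : ℝ≥0∞) * v + b * w) * ρ = a * (v * ρ) + b * (w * ρ) := by ring
      _ ≤ a * (monotoneConjugate Φ v + Φ ρ) + b * (monotoneConjugate Φ w + Φ ρ) :=
          add_le_add (mul_le_mul_right (h v) _) (mul_le_mul_right (h w) _)
      _ = a * monotoneConjugate Φ v + b * monotoneConjugate Φ w + (a + b) * Φ ρ := by ring
      _ = _ := by rw [hab', one_mul]
  refine ⟨hzero, hfin, ?_, ?_, hconv⟩
  · obtain ⟨ρ, hρ⟩ := hpos 1 one_pos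
    have hρ0 : ρ ≠ 0 := by rintro rfl; simp at hρ
    refine top_le_iff.mp (le_trans ?_ (le_iSup _ ρ))
    have h1 : Φ ρ ≠ ∞ := hρ.ne_top
    rw [ENNReal.top_mul (by exact_mod_cast hρ0), ENNReal.top_sub h1]
  · intro v w hvw
    have hw : 0 < w := lt_of_le_of_lt (zero_le) hvw
    obtain ⟨ρ, hρ⟩ := hpos w hw
    have hwpos : monotoneConjugate Φ w ≠ 0 :=
      ((tsub_pos_of_lt hρ).trans_le (le_iSup (fun ρ : ℝ≥0 => (w : ℝ≥0∞) * ρ - Φ ρ) ρ)).ne'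
    have hle : v / w ≤ 1 := (div_le_one hw).mpr hvw.le
    have := hconv.2 (Set.mem_univ w) (Set.mem_univ 0) (zero_le : 0 ≤ v / w)
      (zero_le : 0 ≤ 1 - v / w) (add_tsub_cancel_of_le hle)
    have hv : (v / w) • w + (1 - v / w) • (0 : ℝ≥0) = v := by
      simp [div_mul_cancel₀ _ hw.ne']
    simp only at this
    rw [hv] at this
    refine this.trans_lt ?_
    simp only [ENNReal.coe_zero, hzero, smul_zero, add_zero, ENNReal.smul_def, smul_eq_mul]
    conv_rhs => rw [← one_mul (monotoneConjugate Φ w)]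
    refine ENNReal.mul_lt_mul_left hwpos (hfin w) ?_
    exact_mod_cast (div_lt_one hw).mpr hvw

theorem isTransportFunction_conjugate_max_pow (Φ : ℝ≥0 → ℝ≥0∞) (a k : ℝ) (ha : 0 < a)
    (hk : 2 ≤ k)
    (hΦ : ∀ ρ : ℝ≥0, Φ ρ = ENNReal.ofReal (a * max ((ρ : ℝ) ^ 2) ((ρ : ℝ) ^ k))) :
    IsTransportFunction (monotoneConjugate Φ) := by
  refine isTransportFunction_monotoneConjugate Φ (fun w => ?_) fun w hw => ?_
  -- The quadratic branch alone bounds the conjugate, by w²/(4a).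
  · refine ne_top_of_le_ne_top (ENNReal.ofReal_ne_top (r := (w : ℝ) ^ 2 / (4 * a)))
      (iSup_le fun ρ => ?_)
    rw [tsub_le_iff_right, hΦ, ← ENNReal.ofReal_add (by positivity) (by positivity),
      ← ENNReal.coe_mul, ← ENNReal.ofReal_coe_nnreal]
    refine ENNReal.ofReal_le_ofReal ?_
    push_cast
    calc (w : ℝ) * ρ ≤ (w : ℝ) ^ 2 / (4 * a) + a * (ρ : ℝ) ^ 2 := by
          have : (w : ℝ) ^ 2 / (4 * a) + a * (ρ : ℝ) ^ 2 - w * ρ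
              = (w - 2 * a * ρ) ^ 2 / (4 * a) := by field_simp; ring
          have h2 : 0 ≤ ((w : ℝ) - 2 * a * ρ) ^ 2 / (4 * a) := by positivity
          linarith
      _ ≤ _ := by gcongr; exact le_max_left _ _
  · have hw' : (0 : ℝ) < w := hw
    -- Staying below 1 selects the quadratic branch of the maximum, and r ≤ w/(2a) gives a r² ≤ w r
    -- / 2 < w r.
    set r : ℝ := min 1 (w / (2 * a)) with hr
    have hr0 : 0 < r := lt_min one_pos (by positivity)
    have hr1 : r ≤ 1 := min_le_left _ _
    refine ⟨r.toNNReal, ?_⟩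
    have hmax : max (r ^ 2) (r ^ k) = r ^ 2 := by
      refine max_eq_left ?_
      rw [← Real.rpow_natCast r 2]
      exact Real.rpow_le_rpow_of_exponent_ge hr0 hr1 (by simpa using hk)
    rw [hΦ, Real.coe_toNNReal _ hr0.le, hmax, ← ENNReal.ofReal_coe_nnreal,
      ← ENNReal.ofReal_coe_nnreal, ← ENNReal.ofReal_mul hw'.le, Real.coe_toNNReal _ hr0.le]
    refine (ENNReal.ofReal_lt_ofReal_iff (by positivity)).mpr ?_
    have h1 : r ≤ w / (2 * a) := min_le_right _ _
    rw [le_div_iff₀ (by positivity)] at h1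
    nlinarith

theorem isTransportFunction_conjugate_restricted (Φ : ℝ≥0 → ℝ≥0∞) (K s R : ℝ) (hK : 0 < K)
    (hs : 0 < s) (hR : 0 < R) (hsR : s * R = 1)
    (hΦ : ∀ ρ : ℝ≥0, (ρ : ℝ) < R →
      Φ ρ = ENNReal.ofReal (K * ((ρ * s) ^ 2 / (1 - ρ * s))))
    (hΦ' : ∀ ρ : ℝ≥0, R ≤ (ρ : ℝ) → Φ ρ = ∞) :
    IsTransportFunction (monotoneConjugate Φ) := by
  refine isTransportFunction_monotoneConjugate Φ (fun w => ?_) fun w hw => ?_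
  · refine ne_top_of_le_ne_top (ENNReal.ofReal_ne_top (r := (w : ℝ) * R)) (iSup_le fun ρ => ?_)
    rcases lt_or_ge (ρ : ℝ) R with h | h
    · refine tsub_le_self.trans ?_
      rw [← ENNReal.coe_mul, ← ENNReal.ofReal_coe_nnreal]
      refine ENNReal.ofReal_le_ofReal ?_
      push_cast
      gcongr
    · simp [hΦ' ρ h]
  · have hw' : (0 : ℝ) < w := hw
    -- With r ≤ R/2 the denominator is at least 1/2, and the second bound then gives a value of at
    -- most w r / 2.
    set r : ℝ := min (R / 2) (w / (4 * K * s ^ 2)) with hr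
    have hr0 : 0 < r := lt_min (by positivity) (by positivity)
    have hr1 : r ≤ R / 2 := min_le_left _ _
    have hr2 : r ≤ w / (4 * K * s ^ 2) := min_le_right _ _
    refine ⟨r.toNNReal, ?_⟩
    rw [hΦ _ (by rw [Real.coe_toNNReal _ hr0.le]; linarith), Real.coe_toNNReal _ hr0.le,
      ← ENNReal.ofReal_coe_nnreal, ← ENNReal.ofReal_coe_nnreal, ← ENNReal.ofReal_mul hw'.le,
      Real.coe_toNNReal _ hr0.le]
    refine (ENNReal.ofReal_lt_ofReal_iff (by positivity)).mpr ?_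
    have hrs : r * s ≤ 1 / 2 := by nlinarith
    rw [← mul_div_assoc, div_lt_iff₀ (by linarith)]
    rw [le_div_iff₀ (by positivity)] at hr2
    have h3 : w * r * (1 / 2) ≤ w * r * (1 - r * s) := by gcongr; linarith
    have h4 : r * (4 * K * s ^ 2) * r ≤ w * r := by gcongr
    have h5 : 0 < w * r := by positivity
    nlinarith

/-! ### Matrices acting on standardized vectors -/

section Matrix

variable {d q : ℕ}

/-- The action of a matrix on a Euclidean vector. -/
def matrixAct (A : Matrix (Fin d) (Fin q) ℝ) (u : EuclideanSpace ℝ (Fin q)) :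
    EuclideanSpace ℝ (Fin d) :=
  WithLp.toLp 2 (A.mulVec u.ofLp)

theorem matrixAct_apply (A : Matrix (Fin d) (Fin q) ℝ) (u : EuclideanSpace ℝ (Fin q))
    (i : Fin d) : matrixAct A u i = ∑ j, A i j * u j := rfl

theorem matrixAct_sub_right (A : Matrix (Fin d) (Fin q) ℝ) (u v : EuclideanSpace ℝ (Fin q)) :
    matrixAct A (u - v) = matrixAct A u - matrixAct A v := by
  ext i
  simp [matrixAct_apply, mul_sub, Finset.sum_sub_distrib]

theorem matrixAct_sub_left (A B : Matrix (Fin d) (Fin q) ℝ) (u : EuclideanSpace ℝ (Fin q)) :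
    matrixAct (A - B) u = matrixAct A u - matrixAct B u := by
  ext i
  simp [matrixAct_apply, sub_mul, Finset.sum_sub_distrib]

theorem trace_mul_transpose_eq_sum (A : Matrix (Fin d) (Fin q) ℝ) :
    (A * A.transpose).trace = ∑ i, ∑ j, A i j ^ 2 := by
  simp [Matrix.trace, Matrix.mul_apply, sq]

theorem frobeniusNorm_nonneg (A : Matrix (Fin d) (Fin q) ℝ) : 0 ≤ frobeniusNorm A :=
  Real.sqrt_nonneg _

theorem frobeniusNorm_sq_eq_trace (A : Matrix (Fin d) (Fin q) ℝ) :
    frobeniusNorm A ^ 2 = (A * A.transpose).trace := by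
  rw [frobeniusNorm, Real.sq_sqrt]
  rw [trace_mul_transpose_eq_sum]
  positivity

theorem frobeniusNorm_sq (A : Matrix (Fin d) (Fin q) ℝ) :
    frobeniusNorm A ^ 2 = ∑ i, ∑ j, A i j ^ 2 := by
  rw [frobeniusNorm_sq_eq_trace, trace_mul_transpose_eq_sum]

theorem abs_apply_le_frobeniusNorm (A : Matrix (Fin d) (Fin q) ℝ) (i : Fin d) (j : Fin q) :
    |A i j| ≤ frobeniusNorm A := by
  refine abs_le_of_sq_le_sq ?_ (frobeniusNorm_nonneg A)
  rw [frobeniusNorm_sq]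
  calc A i j ^ 2 ≤ ∑ j, A i j ^ 2 :=
        Finset.single_le_sum (f := fun j => A i j ^ 2) (fun _ _ => sq_nonneg _) (Finset.mem_univ j)
    _ ≤ _ := Finset.single_le_sum (f := fun i => ∑ j, A i j ^ 2)
        (fun _ _ => Finset.sum_nonneg fun _ _ => sq_nonneg _) (Finset.mem_univ i)

theorem norm_matrixAct_le (A : Matrix (Fin d) (Fin q) ℝ) (u : EuclideanSpace ℝ (Fin q)) :
    ‖matrixAct A u‖ ≤ frobeniusNorm A * ‖u‖ := by
  refine le_of_sq_le_sq ?_ (mul_nonneg (frobeniusNorm_nonneg A) (norm_nonneg u))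
  rw [mul_pow, frobeniusNorm_sq, EuclideanSpace.norm_sq_eq, EuclideanSpace.norm_sq_eq,
    Finset.sum_mul]
  refine Finset.sum_le_sum fun i _ => ?_
  simp only [Real.norm_eq_abs, sq_abs, matrixAct_apply]
  exact Finset.sum_mul_sq_le_sq_mul_sq _ _ _

theorem continuous_matrixAct (A : Matrix (Fin d) (Fin q) ℝ) : Continuous (matrixAct A) := by
  refine LipschitzWith.continuous (K := ⟨frobeniusNorm A, frobeniusNorm_nonneg A⟩) ?_
  refine LipschitzWith.of_dist_le_mul fun u v => ?_
  rw [dist_eq_norm, dist_eq_norm, ← matrixAct_sub_right]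
  exact norm_matrixAct_le A _

variable {μ : Measure (EuclideanSpace ℝ (Fin q))}

theorem IsStandardized.integrable_norm [IsProbabilityMeasure μ] (hμ : IsStandardized μ) :
    Integrable (fun u => ‖u‖) μ := by
  refine ((integrable_const 1).add hμ.integrable_sq).mono' (by fun_prop) ?_
  filter_upwards with u
  simp only [norm_norm, Pi.add_apply]
  nlinarith [sq_nonneg (‖u‖ - 1)]

theorem IsStandardized.integrable_coord [IsProbabilityMeasure μ] (hμ : IsStandardized μ) (i : Fin q) :
    Integrable (fun u : EuclideanSpace ℝ (Fin q) => u i) μ := by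
  refine hμ.integrable_norm.mono' (by fun_prop) ?_
  filter_upwards with u
  exact PiLp.norm_apply_le u i

theorem IsStandardized.integrable_coord_mul (hμ : IsStandardized μ) (i j : Fin q) :
    Integrable (fun u : EuclideanSpace ℝ (Fin q) => u i * u j) μ := by
  refine hμ.integrable_sq.mono' (by fun_prop) ?_
  filter_upwards with u
  rw [norm_mul, sq]
  exact mul_le_mul (PiLp.norm_apply_le u i) (PiLp.norm_apply_le u j) (norm_nonneg _)
    (norm_nonneg _)

theorem IsStandardized.integral_inner_matrixAct [IsProbabilityMeasure μ] (hμ : IsStandardized μ)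
    (A : Matrix (Fin d) (Fin q) ℝ) (a : EuclideanSpace ℝ (Fin d)) :
    Integrable (fun u => ⟪a, matrixAct A u⟫) μ ∧ ∫ u, ⟪a, matrixAct A u⟫ ∂μ = 0 := by
  have e : ∀ u, ⟪a, matrixAct A u⟫ = ∑ i, ∑ j, a i * A i j * u j := by
    intro u
    rw [PiLp.inner_apply]
    refine Finset.sum_congr rfl fun i _ => ?_
    rw [matrixAct_apply, RCLike.inner_apply, conj_trivial, Finset.sum_mul]
    exact Finset.sum_congr rfl fun j _ => by ring
  have hi : ∀ i j, Integrable (fun u : EuclideanSpace ℝ (Fin q) => a i * A i j * u j) μ :=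
    fun i j => (hμ.integrable_coord j).const_mul _
  simp_rw [e]
  refine ⟨integrable_finsetSum _ fun i _ => integrable_finsetSum _ fun j _ => hi i j, ?_⟩
  rw [integral_finsetSum _ fun i _ => integrable_finsetSum _ fun j _ => hi i j]
  refine Finset.sum_eq_zero fun i _ => ?_
  rw [integral_finsetSum _ fun j _ => hi i j]
  refine Finset.sum_eq_zero fun j _ => ?_
  rw [integral_const_mul, hμ.mean, mul_zero]

theorem IsStandardized.integral_norm_sq_matrixAct (hμ : IsStandardized μ)
    (A : Matrix (Fin d) (Fin q) ℝ) :
    Integrable (fun u => ‖matrixAct A u‖ ^ 2) μ ∧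
      ∫ u, ‖matrixAct A u‖ ^ 2 ∂μ = frobeniusNorm A ^ 2 := by
  have e : ∀ u, ‖matrixAct A u‖ ^ 2 = ∑ i, ∑ j, ∑ k, A i j * A i k * (u j * u k) := by
    intro u
    rw [EuclideanSpace.norm_sq_eq]
    refine Finset.sum_congr rfl fun i _ => ?_
    rw [Real.norm_eq_abs, sq_abs, matrixAct_apply, sq, Finset.sum_mul_sum]
    exact Finset.sum_congr rfl fun j _ => Finset.sum_congr rfl fun k _ => by ring
  have hi : ∀ i j k, Integrable
      (fun u : EuclideanSpace ℝ (Fin q) => A i j * A i k * (u j * u k)) μ :=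
    fun i j k => (hμ.integrable_coord_mul j k).const_mul _
  simp_rw [e]
  refine ⟨integrable_finsetSum _ fun i _ => integrable_finsetSum _ fun j _ =>
    integrable_finsetSum _ fun k _ => hi i j k, ?_⟩
  rw [integral_finsetSum _ fun i _ => integrable_finsetSum _ fun j _ =>
    integrable_finsetSum _ fun k _ => hi i j k, frobeniusNorm_sq]
  refine Finset.sum_congr rfl fun i _ => ?_
  rw [integral_finsetSum _ fun j _ => integrable_finsetSum _ fun k _ => hi i j k]
  refine Finset.sum_congr rfl fun j _ => ?_
  rw [integral_finsetSum _ fun k _ => hi i j k]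
  simp_rw [integral_const_mul, hμ.cov]
  simp [sq]

/-- The cross term has mean zero and identity covariance turns E|AU|² into the squared Frobenius
norm; nonnegativity of the variance then passes from the second moment to the first. -/
theorem IsStandardized.integral_norm_add_matrixAct_le [IsProbabilityMeasure μ] (hμ : IsStandardized μ)
    (A : Matrix (Fin d) (Fin q) ℝ) (a : EuclideanSpace ℝ (Fin d)) (r s : ℝ) (hs : 0 ≤ s)
    (h : ‖a‖ ^ 2 + r ^ 2 * frobeniusNorm A ^ 2 ≤ s ^ 2) :
    Integrable (fun u => ‖a + r • matrixAct A u‖) μ ∧ ∫ u, ‖a + r • matrixAct A u‖ ∂μ ≤ s := by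
  obtain ⟨i1, e1⟩ := hμ.integral_inner_matrixAct A a
  obtain ⟨i2, e2⟩ := hμ.integral_norm_sq_matrixAct A
  have hexp : ∀ u, ‖a + r • matrixAct A u‖ ^ 2
      = ‖a‖ ^ 2 + 2 * r * ⟪a, matrixAct A u⟫ + r ^ 2 * ‖matrixAct A u‖ ^ 2 := by
    intro u
    rw [norm_add_sq_real, inner_smul_right, norm_smul, mul_pow, Real.norm_eq_abs, sq_abs]
    ring
  have i0 : Integrable (fun u => ‖a + r • matrixAct A u‖ ^ 2) μ := by
    simp_rw [hexp]
    exact ((integrable_const _).add (i1.const_mul _)).add (i2.const_mul _)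
  have e0 : ∫ u, ‖a + r • matrixAct A u‖ ^ 2 ∂μ ≤ s ^ 2 := by
    simp_rw [hexp]
    have j : Integrable (fun u => ‖a‖ ^ 2 + 2 * r * ⟪a, matrixAct A u⟫) μ :=
      (integrable_const _).add (i1.const_mul _)
    rw [integral_add j (i2.const_mul _), integral_add (integrable_const _) (i1.const_mul _), integral_const_mul, integral_const_mul,
      e1, e2]
    simpa using h
  have hc := continuous_matrixAct A
  have hi : Integrable (fun u => ‖a + r • matrixAct A u‖) μ := by
    refine ((integrable_const 1).add i0).mono' (by fun_prop) ?_
    filter_upwards with u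
    simp only [norm_norm, Pi.add_apply]
    nlinarith [sq_nonneg (‖a + r • matrixAct A u‖ - 1)]
  refine ⟨hi, ?_⟩
  set I := ∫ u, ‖a + r • matrixAct A u‖ ∂μ with hI
  have hvar : 0 ≤ ∫ u, (‖a + r • matrixAct A u‖ - I) ^ 2 ∂μ := integral_nonneg fun _ => sq_nonneg _
  have e3 : ∫ u, (‖a + r • matrixAct A u‖ - I) ^ 2 ∂μ
      = ∫ u, ‖a + r • matrixAct A u‖ ^ 2 ∂μ - I ^ 2 := by
    have : ∀ u, (‖a + r • matrixAct A u‖ - I) ^ 2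
        = ‖a + r • matrixAct A u‖ ^ 2 - 2 * I * ‖a + r • matrixAct A u‖ + I ^ 2 := by
      intro u; ring
    simp_rw [this]
    have j : Integrable
        (fun u => ‖a + r • matrixAct A u‖ ^ 2 - 2 * I * ‖a + r • matrixAct A u‖) μ :=
      i0.sub (hi.const_mul _)
    rw [integral_add j (integrable_const _), integral_sub i0 (hi.const_mul _), integral_const_mul, ← hI]
    simp
    ring
  exact le_of_sq_le_sq (by linarith) hs

end Matrix

/-! ### One step of the scheme -/

/-- One step of the scheme, for frozen coefficients `b₀` and `σ₀`. -/
noncomputable def eulerStep {d q : ℕ} (b₀ : EuclideanSpace ℝ (Fin d) → EuclideanSpace ℝ (Fin d))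
    (σ₀ : EuclideanSpace ℝ (Fin d) → Matrix (Fin d) (Fin q) ℝ) (Δ : ℝ)
    (y : EuclideanSpace ℝ (Fin d)) (u : EuclideanSpace ℝ (Fin q)) : EuclideanSpace ℝ (Fin d) :=
  y + Δ • b₀ y + Real.sqrt Δ • matrixAct (σ₀ y) u

section Step

variable {d q : ℕ} {b₀ : EuclideanSpace ℝ (Fin d) → EuclideanSpace ℝ (Fin d)}
  {σ₀ : EuclideanSpace ℝ (Fin d) → Matrix (Fin d) (Fin q) ℝ} {Δ Lb Lσ : ℝ}

theorem continuous_of_norm_sub_le {E F : Type*} [SeminormedAddCommGroup E]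
    [SeminormedAddCommGroup F] {f : E → F} {K : ℝ} (h : ∀ x y, ‖f x - f y‖ ≤ K * ‖x - y‖) :
    Continuous f := by
  refine (LipschitzWith.of_dist_le_mul (K := K.toNNReal) fun x y => ?_).continuous
  rw [dist_eq_norm, dist_eq_norm]
  exact (h x y).trans (mul_le_mul_of_nonneg_right (Real.le_coe_toNNReal K) (norm_nonneg _))

theorem continuous_eulerStep (hb : ∀ x y, ‖b₀ x - b₀ y‖ ≤ Lb * ‖x - y‖)
    (hσ : ∀ x y, frobeniusNorm (σ₀ x - σ₀ y) ≤ Lσ * ‖x - y‖) :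
    Continuous (fun z : EuclideanSpace ℝ (Fin d) × EuclideanSpace ℝ (Fin q) =>
      eulerStep b₀ σ₀ Δ z.1 z.2) := by
  have hb' : Continuous b₀ := continuous_of_norm_sub_le hb
  have hσ' : ∀ i j, Continuous fun x => σ₀ x i j := fun i j =>
    continuous_of_norm_sub_le fun x y =>
      (abs_apply_le_frobeniusNorm (σ₀ x - σ₀ y) i j).trans (hσ x y)
  have hact : Continuous (fun z : EuclideanSpace ℝ (Fin d) × EuclideanSpace ℝ (Fin q) =>
      matrixAct (σ₀ z.1) z.2) := by
    refine (PiLp.continuous_toLp 2 _).comp (continuous_pi fun i => ?_)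
    simp only [Matrix.mulVec, dotProduct]
    refine continuous_finsetSum _ fun j _ => ?_
    exact ((hσ' i j).comp continuous_fst).mul
      ((EuclideanSpace.proj j).continuous.comp continuous_snd)
  unfold eulerStep
  fun_prop

theorem lipschitz_eulerStep_right (y : EuclideanSpace ℝ (Fin d))
    (u v : EuclideanSpace ℝ (Fin q)) :
    ‖eulerStep b₀ σ₀ Δ y u - eulerStep b₀ σ₀ Δ y v‖
      ≤ Real.sqrt Δ * frobeniusNorm (σ₀ y) * ‖u - v‖ := by
  rw [eulerStep, eulerStep, add_sub_add_left_eq_sub, ← smul_sub, ← matrixAct_sub_right, norm_smul,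
    Real.norm_eq_abs, abs_of_nonneg (Real.sqrt_nonneg _), mul_assoc]
  exact mul_le_mul_of_nonneg_left (norm_matrixAct_le _ _) (Real.sqrt_nonneg _)

/-- Two copies driven by the same innovation are compared in mean square; (1 + Δ[b]₁)² + Δ[σ]₁² is
exactly 1 + C(Δ)Δ, the origin of that constant. -/
theorem integral_norm_eulerStep_sub_le {μ : Measure (EuclideanSpace ℝ (Fin q))}
    [IsProbabilityMeasure μ] (hμ : IsStandardized μ) (hΔ : 0 ≤ Δ) (hLb : 0 ≤ Lb)
    (hb : ∀ x y, ‖b₀ x - b₀ y‖ ≤ Lb * ‖x - y‖)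
    (hσ : ∀ x y, frobeniusNorm (σ₀ x - σ₀ y) ≤ Lσ * ‖x - y‖) (y z : EuclideanSpace ℝ (Fin d)) :
    Integrable (fun u => ‖eulerStep b₀ σ₀ Δ y u - eulerStep b₀ σ₀ Δ z u‖) μ ∧
    ∫ u, ‖eulerStep b₀ σ₀ Δ y u - eulerStep b₀ σ₀ Δ z u‖ ∂μ
      ≤ Real.sqrt (1 + (2 * Lb + Lσ ^ 2 + Δ * Lb ^ 2) * Δ) * ‖y - z‖ := by
  have e : ∀ u, eulerStep b₀ σ₀ Δ y u - eulerStep b₀ σ₀ Δ z u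
      = ((y - z) + Δ • (b₀ y - b₀ z)) + Real.sqrt Δ • matrixAct (σ₀ y - σ₀ z) u := by
    intro u
    rw [eulerStep, eulerStep, matrixAct_sub_left, smul_sub, smul_sub]
    abel
  simp_rw [e]
  refine hμ.integral_norm_add_matrixAct_le _ _ _ _ (by positivity) ?_
  rw [mul_pow, Real.sq_sqrt hΔ, Real.sq_sqrt (by positivity)]
  have h1 : ‖(y - z) + Δ • (b₀ y - b₀ z)‖ ≤ (1 + Δ * Lb) * ‖y - z‖ := by
    refine (norm_add_le _ _).trans ?_
    rw [norm_smul, Real.norm_eq_abs, abs_of_nonneg hΔ]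
    have := mul_le_mul_of_nonneg_left (hb y z) hΔ
    linarith
  have h2 : frobeniusNorm (σ₀ y - σ₀ z) ^ 2 ≤ (Lσ * ‖y - z‖) ^ 2 :=
    pow_le_pow_left₀ (frobeniusNorm_nonneg _) (hσ y z) 2
  have h3 := pow_le_pow_left₀ (norm_nonneg _) h1 2
  have h4 := mul_le_mul_of_nonneg_left h2 hΔ
  nlinarith

theorem GaussianConcentration.of_lipschitz {μ : Measure (EuclideanSpace ℝ (Fin q))}
    {β : ℝ} (hGC : GaussianConcentration μ β) {g : EuclideanSpace ℝ (Fin q) → ℝ} {K : ℝ}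
    (hK : 0 < K) (hg : ∀ u v, |g u - g v| ≤ K * ‖u - v‖) :
    Integrable g μ ∧ ∀ l : ℝ, 0 ≤ l → Integrable (fun u => Real.exp (l * g u)) μ ∧
      ∫ u, Real.exp (l * g u) ∂μ ≤ Real.exp (l * ∫ u, g u ∂μ + β * (l * K) ^ 2 / 4) := by
  have hf : LipschitzWith 1 fun u => g u / K := by
    refine LipschitzWith.of_dist_le_mul fun u v => ?_
    rw [Real.dist_eq, ← sub_div, abs_div, abs_of_pos hK, div_le_iff₀ hK, dist_eq_norm,
      NNReal.coe_one, one_mul, mul_comm]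
    exact hg u v
  obtain ⟨h1, h2⟩ := hGC _ hf
  have hgi : Integrable g μ := by
    simpa [div_mul_cancel₀ _ hK.ne'] using h1.mul_const K
  refine ⟨hgi, fun l hl => ?_⟩
  have h3 := h2 (l * K) (by positivity)
  have e : ∀ r, l * K * (r / K) = l * r := fun r => by field_simp
  simp_rw [integral_div, e] at h3
  exact h3

end Step

/-! ### Exponential moments -/

/-- The exponential, with values in `ℝ≥0∞`. -/
noncomputable def eexp (a : ℝ) : ℝ≥0∞ := ENNReal.ofReal (Real.exp a)

theorem eexp_add (a b : ℝ) : eexp (a + b) = eexp a * eexp b := by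
  rw [eexp, Real.exp_add, ENNReal.ofReal_mul (Real.exp_pos a).le, eexp, eexp]

theorem eexp_rpow (a r : ℝ) : eexp a ^ r = eexp (a * r) := by
  rw [eexp, ENNReal.ofReal_rpow_of_pos (Real.exp_pos a), ← Real.exp_mul, eexp]

theorem eexp_le_eexp {a b : ℝ} (h : a ≤ b) : eexp a ≤ eexp b :=
  ENNReal.ofReal_le_ofReal (Real.exp_le_exp.mpr h)

theorem eexp_ne_top (a : ℝ) : eexp a ≠ ∞ := ENNReal.ofReal_ne_top

theorem measurable_eexp : Measurable eexp := Real.measurable_exp.ennreal_ofReal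

section eexp

variable {E : Type*} [MeasurableSpace E] {m : Measure E}

theorem lintegral_eexp_eq {f : E → ℝ} (h : Integrable (fun y => Real.exp (f y)) m) :
    ∫⁻ y, eexp (f y) ∂m = ENNReal.ofReal (∫ y, Real.exp (f y) ∂m) :=
  (ofReal_integral_eq_lintegral_ofReal h (ae_of_all _ fun _ => (Real.exp_pos _).le)).symm

theorem integrable_exp_of_lintegral_eexp_ne_top {f : E → ℝ} (hf : AEMeasurable f m)
    (h : ∫⁻ y, eexp (f y) ∂m ≠ ∞) : Integrable (fun y => Real.exp (f y)) m := by
  refine ⟨(Real.measurable_exp.comp_aemeasurable hf).aestronglyMeasurable, ?_⟩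
  rw [hasFiniteIntegral_iff_ofReal (ae_of_all _ fun _ => (Real.exp_pos _).le)]
  exact lt_top_iff_ne_top.mpr h

/-- Estimates are chained in ℝ≥0∞, where no integrability is needed; a finite bound at the end
yields integrability and the Bochner estimate together. -/
theorem integrable_exp_and_integral_le {f : E → ℝ} (hf : AEMeasurable f m) {a : ℝ}
    (h : ∫⁻ y, eexp (f y) ∂m ≤ eexp a) :
    Integrable (fun y => Real.exp (f y)) m ∧ ∫ y, Real.exp (f y) ∂m ≤ Real.exp a := by
  have hi := integrable_exp_of_lintegral_eexp_ne_top hf (ne_top_of_le_ne_top (eexp_ne_top a) h)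
  refine ⟨hi, ?_⟩
  rw [lintegral_eexp_eq hi] at h
  exact (ENNReal.ofReal_le_ofReal_iff (Real.exp_pos a).le).mp h

theorem lintegral_eexp_add_le {f g : E → ℝ} (hf : AEMeasurable f m) (hg : AEMeasurable g m) :
    ∫⁻ y, eexp (f y + g y) ∂m
      ≤ (∫⁻ y, eexp (2 * f y) ∂m) ^ (1 / 2 : ℝ) * (∫⁻ y, eexp (2 * g y) ∂m) ^ (1 / 2 : ℝ) := by
  have h := ENNReal.lintegral_mul_norm_pow_le (μ := m)
    (measurable_eexp.comp_aemeasurable (hf.const_mul 2))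
    (measurable_eexp.comp_aemeasurable (hg.const_mul 2))
    (p := 1 / 2) (q := 1 / 2) (by norm_num) (by norm_num) (by norm_num)
  refine le_trans (le_of_eq ?_) h
  refine lintegral_congr fun y => ?_
  simp only [Function.comp, eexp_rpow, ← eexp_add]
  congr 1
  ring

/-- Jensen's inequality, as Hölder against the constant 1. It lets a moment bound scale linearly in
the exponent, here with θ = 1/N or θ proportional to t². -/
theorem lintegral_eexp_mul_le [IsProbabilityMeasure m] {f : E → ℝ} (hf : AEMeasurable f m)
    {θ : ℝ} (h0 : 0 ≤ θ) (h1 : θ ≤ 1) :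
    ∫⁻ y, eexp (f y * θ) ∂m ≤ (∫⁻ y, eexp (f y) ∂m) ^ θ := by
  have h := ENNReal.lintegral_mul_norm_pow_le (μ := m)
    (measurable_eexp.comp_aemeasurable hf) (aemeasurable_const (b := (1 : ℝ≥0∞)))
    h0 (sub_nonneg.mpr h1) (by ring)
  simpa [Function.comp, eexp_rpow] using h

end eexp

theorem GaussianConcentration.lintegral_eexp_le {q : ℕ} {μ : Measure (EuclideanSpace ℝ (Fin q))}
    {β : ℝ} (hGC : GaussianConcentration μ β) {g : EuclideanSpace ℝ (Fin q) → ℝ} {K : ℝ}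
    (hK : 0 < K) (hg : ∀ u v, |g u - g v| ≤ K * ‖u - v‖) {l : ℝ} (hl : 0 ≤ l) :
    ∫⁻ u, eexp (l * g u) ∂μ ≤ eexp (l * ∫ u, g u ∂μ + β * (l * K) ^ 2 / 4) := by
  obtain ⟨h1, h2⟩ := (hGC.of_lipschitz hK hg).2 l hl
  rw [lintegral_eexp_eq h1]
  exact ENNReal.ofReal_le_ofReal h2

/-! ### The Lyapunov function along one step -/

section Lyapunov

variable {d q : ℕ}

/-- Second-order Taylor bound: along the segment, V minus its linear part minus η s²|h|² is
nonincreasing in s, since the gradient is 2η-Lipschitz. -/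
theorem le_add_inner_gradient_add_sq {V : EuclideanSpace ℝ (Fin d) → ℝ} {η : ℝ}
    (hV : ContDiff ℝ 2 V) (hess : ∀ x, ‖fderiv ℝ (fderiv ℝ V) x‖ ≤ 2 * η)
    (y h : EuclideanSpace ℝ (Fin d)) :
    V (y + h) ≤ V y + ⟪gradient V y, h⟫ + η * ‖h‖ ^ 2 := by
  have hd : Differentiable ℝ V := hV.differentiable (by norm_num)
  have hd2 : Differentiable ℝ (fderiv ℝ V) :=
    (hV.fderiv_right (m := 1) (by norm_num)).differentiable (by norm_num)
  rw [inner_gradient_left]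
  let g : ℝ → ℝ := fun s => V (y + s • h) - s * fderiv ℝ V y h - η * s ^ 2 * ‖h‖ ^ 2
  have hg : ∀ s, HasDerivAt g
      (fderiv ℝ V (y + s • h) h - fderiv ℝ V y h - η * (2 * s) * ‖h‖ ^ 2) s := by
    intro s
    have h1 : HasDerivAt (fun s : ℝ => y + s • h) h s := by
      simpa using ((hasDerivAt_id s).smul_const h).const_add y
    have h2 := (hd (y + s • h)).hasFDerivAt.comp_hasDerivAt s h1
    have h3 : HasDerivAt (fun s : ℝ => s * fderiv ℝ V y h) (fderiv ℝ V y h) s := by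
      simpa using (hasDerivAt_id s).mul_const (fderiv ℝ V y h)
    have h4 : HasDerivAt (fun s : ℝ => η * s ^ 2 * ‖h‖ ^ 2) (η * (2 * s) * ‖h‖ ^ 2) s := by
      simpa using ((hasDerivAt_pow 2 s).const_mul η).mul_const (‖h‖ ^ 2)
    exact (h2.sub h3).sub h4
  have hanti : AntitoneOn g (Set.Icc 0 1) := by
    refine antitoneOn_of_deriv_nonpos (convex_Icc 0 1)
      (fun s _ => (hg s).continuousAt.continuousWithinAt)
      (fun s _ => (hg s).differentiableAt.differentiableWithinAt) fun s hs => ?_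
    rw [interior_Icc] at hs
    rw [(hg s).deriv]
    have h1 : ‖fderiv ℝ V (y + s • h) - fderiv ℝ V y‖ ≤ 2 * η * ‖y + s • h - y‖ :=
      convex_univ.norm_image_sub_le_of_norm_fderiv_le (𝕜 := ℝ) (fun z _ => hd2 z)
        (fun z _ => hess z) (Set.mem_univ _) (Set.mem_univ _)
    rw [add_sub_cancel_left, norm_smul, Real.norm_eq_abs, abs_of_pos hs.1] at h1
    have h2 := (le_abs_self _).trans
      ((fderiv ℝ V (y + s • h) - fderiv ℝ V y).le_opNorm h)
    rw [sub_apply] at h2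
    have h3 := mul_le_mul_of_nonneg_right h1 (norm_nonneg h)
    nlinarith
  have := hanti (Set.left_mem_Icc.mpr zero_le_one) (Set.right_mem_Icc.mpr zero_le_one) zero_le_one
  simp only [g, one_smul, zero_smul, add_zero] at this
  linarith

theorem rpow_le_rpow_add_mul_sub {v w α : ℝ} (hv : 0 < v) (hw : 0 < w) (h0 : 0 ≤ α)
    (h1 : α ≤ 1) : w ^ α ≤ v ^ α + α * v ^ (α - 1) * (w - v) := by
  have h := rpow_one_add_le_one_add_mul_self (s := w / v - 1)
    (by have : 0 < w / v := by positivity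
        linarith) h0 h1
  rw [add_sub_cancel, Real.div_rpow hw.le hv.le, div_le_iff₀ (by positivity)] at h
  rw [Real.rpow_sub_one hv.ne']
  refine h.trans (le_of_eq ?_)
  field_simp

variable {V : EuclideanSpace ℝ (Fin d) → ℝ} {Δ α η CV Cb Cσ : ℝ}

/-- A discrete Itô inequality: Taylor for V, then the tangent line of the concave map v ↦ v^α. The
tangent slope α v^{α-1} cancels the growth v^{1-α} of σσ*, so the term in |u|² no longer depends on
y; the remaining noise is linear in u. -/
theorem rpow_eulerStep_le
    (hV : ContDiff ℝ 2 V) (hpos : ∀ x, 0 < V x)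
    (hgrad : ∀ x, ‖gradient V x‖ ^ 2 ≤ CV * V x)
    (hess : ∀ x, ‖fderiv ℝ (fderiv ℝ V) x‖ ≤ 2 * η) (hη : 0 ≤ η) (hΔ : 0 ≤ Δ)
    (hα0 : 0 ≤ α) (hα1 : α ≤ 1) (hCV : 0 ≤ CV) (hCb : 0 ≤ Cb)
    (b₀ : EuclideanSpace ℝ (Fin d) → EuclideanSpace ℝ (Fin d))
    (σ₀ : EuclideanSpace ℝ (Fin d) → Matrix (Fin d) (Fin q) ℝ) (y : EuclideanSpace ℝ (Fin d))
    (hb : ‖b₀ y‖ ^ 2 ≤ Cb * V y) (hσ : frobeniusNorm (σ₀ y) ^ 2 ≤ Cσ * V y ^ (1 - α))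
    (u : EuclideanSpace ℝ (Fin q)) :
    V (eulerStep b₀ σ₀ Δ y u) ^ α
      ≤ V y ^ α * (1 + α * (Real.sqrt (CV * Cb) + η * Cb * Δ) * Δ)
        + ⟪(Real.sqrt Δ * (α * V y ^ (α - 1))) • (gradient V y + (2 * η * Δ) • b₀ y),
            matrixAct (σ₀ y) u⟫
        + α * η * Cσ * Δ * ‖u‖ ^ 2 := by
  have hv := hpos y
  set v := V y with hvdef
  set G := gradient V y
  set a := b₀ y
  set S := matrixAct (σ₀ y) u with hS
  have hT := le_add_inner_gradient_add_sq hV hess y (Δ • a + Real.sqrt Δ • S)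
  rw [← add_assoc] at hT
  change V (eulerStep b₀ σ₀ Δ y u) ≤ _ at hT
  have hsq : Real.sqrt Δ ^ 2 = Δ := Real.sq_sqrt hΔ
  have e1 : ⟪G, Δ • a + Real.sqrt Δ • S⟫ = Δ * ⟪G, a⟫ + Real.sqrt Δ * ⟪G, S⟫ := by
    rw [inner_add_right, inner_smul_right, inner_smul_right]
  have e2 : ‖Δ • a + Real.sqrt Δ • S‖ ^ 2
      = Δ ^ 2 * ‖a‖ ^ 2 + 2 * Δ * Real.sqrt Δ * ⟪a, S⟫ + Δ * ‖S‖ ^ 2 := by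
    rw [norm_add_sq_real, real_inner_smul_left, inner_smul_right, norm_smul, norm_smul, mul_pow,
      mul_pow, Real.norm_eq_abs, Real.norm_eq_abs, sq_abs, sq_abs, hsq]
    ring
  have e3 : ⟪(Real.sqrt Δ * (α * v ^ (α - 1))) • (G + (2 * η * Δ) • a), S⟫
      = α * v ^ (α - 1) * (Real.sqrt Δ * (⟪G, S⟫ + 2 * η * Δ * ⟪a, S⟫)) := by
    rw [real_inner_smul_left, inner_add_left, real_inner_smul_left]
    ring
  have hGa : ⟪G, a⟫ ≤ Real.sqrt (CV * Cb) * v := by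
    refine (real_inner_le_norm G a).trans (le_of_sq_le_sq ?_ (by positivity))
    rw [mul_pow, mul_pow, Real.sq_sqrt (by positivity)]
    calc ‖G‖ ^ 2 * ‖a‖ ^ 2 ≤ (CV * v) * (Cb * v) :=
          mul_le_mul (hgrad y) hb (sq_nonneg _) (by positivity)
      _ = _ := by ring
  have hS2 : ‖S‖ ^ 2 ≤ Cσ * v ^ (1 - α) * ‖u‖ ^ 2 := by
    calc ‖S‖ ^ 2 ≤ (frobeniusNorm (σ₀ y) * ‖u‖) ^ 2 :=
          pow_le_pow_left₀ (norm_nonneg _) (norm_matrixAct_le _ _) 2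
      _ ≤ _ := by rw [mul_pow]; gcongr
  have hinc : V (eulerStep b₀ σ₀ Δ y u) - v ≤ v * ((Real.sqrt (CV * Cb) + η * Cb * Δ) * Δ)
      + Real.sqrt Δ * (⟪G, S⟫ + 2 * η * Δ * ⟪a, S⟫) + η * Δ * (Cσ * v ^ (1 - α) * ‖u‖ ^ 2) := by
    rw [e1, e2] at hT
    have t1 := mul_le_mul_of_nonneg_left hGa hΔ
    have t2 := mul_le_mul_of_nonneg_left hb (by positivity : 0 ≤ η * Δ ^ 2)
    have t3 := mul_le_mul_of_nonneg_left hS2 (by positivity : 0 ≤ η * Δ)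
    nlinarith
  have hw : 0 ≤ α * v ^ (α - 1) := by positivity
  have hfin := rpow_le_rpow_add_mul_sub hv (hpos (eulerStep b₀ σ₀ Δ y u)) hα0 hα1
  refine hfin.trans ((add_le_add_right (mul_le_mul_of_nonneg_left hinc hw) _).trans (le_of_eq ?_))
  have p1 : v ^ (α - 1) * v = v ^ α := by
    rw [← Real.rpow_add_one hv.ne']; congr 1; ring
  have p2 : v ^ (α - 1) * v ^ (1 - α) = 1 := by
    rw [← Real.rpow_add hv]; simp
  rw [e3]
  linear_combination (α * ((Real.sqrt (CV * Cb) + η * Cb * Δ) * Δ)) * p1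
    + (α * η * Δ * Cσ * ‖u‖ ^ 2) * p2

/-- The powers combine as v^{2(α-1)} · v · v^{1-α} = v^α, so Gaussian concentration of the linear
noise charges V^α with a multiple of itself and the estimate closes. -/
theorem norm_noise_coefficient_sq_le (hpos : ∀ x, 0 < V x)
    (hgrad : ∀ x, ‖gradient V x‖ ^ 2 ≤ CV * V x) (hη : 0 ≤ η) (hΔ : 0 ≤ Δ)
    (hCV : 0 ≤ CV) (hCb : 0 ≤ Cb)
    (b₀ : EuclideanSpace ℝ (Fin d) → EuclideanSpace ℝ (Fin d))
    (σ₀ : EuclideanSpace ℝ (Fin d) → Matrix (Fin d) (Fin q) ℝ) (y : EuclideanSpace ℝ (Fin d))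
    (hb : ‖b₀ y‖ ^ 2 ≤ Cb * V y) (hσ : frobeniusNorm (σ₀ y) ^ 2 ≤ Cσ * V y ^ (1 - α)) :
    (‖(Real.sqrt Δ * (α * V y ^ (α - 1))) • (gradient V y + (2 * η * Δ) • b₀ y)‖
        * frobeniusNorm (σ₀ y)) ^ 2
      ≤ Δ * α ^ 2 * Cσ * (1 + 2 * η * Δ) ^ 2 * (CV + Cb) * V y ^ α := by
  have hv := hpos y
  set v := V y with hvdef
  set G := gradient V y
  set a := b₀ y
  set k := 2 * η * Δ with hk
  have hk0 : 0 ≤ k := by positivity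
  have hw : ‖G + k • a‖ ^ 2 ≤ (1 + k) ^ 2 * (CV + Cb) * v := by
    have h1 : ‖G + k • a‖ ≤ ‖G‖ + k * ‖a‖ := by
      refine (norm_add_le _ _).trans (le_of_eq ?_)
      rw [norm_smul, Real.norm_eq_abs, abs_of_nonneg hk0]
    have h2 := pow_le_pow_left₀ (norm_nonneg _) h1 2
    have h3 : (‖G‖ + k * ‖a‖) ^ 2 ≤ (1 + k) ^ 2 * (‖G‖ ^ 2 + ‖a‖ ^ 2) := by
      nlinarith [sq_nonneg (k * ‖G‖ - ‖a‖), mul_nonneg hk0 (sq_nonneg ‖G‖),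
        mul_nonneg hk0 (sq_nonneg ‖a‖)]
    have h4 : ‖G‖ ^ 2 + ‖a‖ ^ 2 ≤ (CV + Cb) * v := by linarith [hgrad y]
    calc _ ≤ _ := h2.trans h3
      _ ≤ (1 + k) ^ 2 * ((CV + Cb) * v) := by gcongr
      _ = _ := by ring
  rw [norm_smul, Real.norm_eq_abs, mul_pow, mul_pow, sq_abs, mul_pow, Real.sq_sqrt hΔ]
  have p1 : (v ^ (α - 1)) ^ 2 * v * v ^ (1 - α) = v ^ α := by
    rw [← Real.rpow_natCast, ← Real.rpow_mul hv.le, ← Real.rpow_add_one hv.ne',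
      ← Real.rpow_add hv]
    congr 1
    push_cast
    ring
  calc Δ * (α * v ^ (α - 1)) ^ 2 * ‖G + k • a‖ ^ 2 * frobeniusNorm (σ₀ y) ^ 2
      ≤ Δ * (α * v ^ (α - 1)) ^ 2 * ((1 + k) ^ 2 * (CV + Cb) * v) * (Cσ * v ^ (1 - α)) := by
        gcongr
    _ = Δ * α ^ 2 * Cσ * (1 + k) ^ 2 * (CV + Cb) * ((v ^ (α - 1)) ^ 2 * v * v ^ (1 - α)) := by
        ring
    _ = _ := by rw [p1]

/-- The exponential moment of `V ^ α` after one step. -/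
theorem lintegral_eexp_rpow_eulerStep_le {μ : Measure (EuclideanSpace ℝ (Fin q))}
    [IsProbabilityMeasure μ] (hμ : IsStandardized μ) {β : ℝ} (hβ : 0 ≤ β)
    (hGC : GaussianConcentration μ β)
    (hV : ContDiff ℝ 2 V) (hpos : ∀ x, 0 < V x)
    (hgrad : ∀ x, ‖gradient V x‖ ^ 2 ≤ CV * V x)
    (hess : ∀ x, ‖fderiv ℝ (fderiv ℝ V) x‖ ≤ 2 * η) (hη : 0 ≤ η) (hΔ : 0 < Δ)
    (hα0 : 0 < α) (hα1 : α ≤ 1) (hCV : 0 < CV) (hCb : 0 < Cb) (hCσ : 0 < Cσ)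
    (b₀ : EuclideanSpace ℝ (Fin d) → EuclideanSpace ℝ (Fin d))
    (σ₀ : EuclideanSpace ℝ (Fin d) → Matrix (Fin d) (Fin q) ℝ) (y : EuclideanSpace ℝ (Fin d))
    (hb : ‖b₀ y‖ ^ 2 ≤ Cb * V y) (hσ : frobeniusNorm (σ₀ y) ^ 2 ≤ Cσ * V y ^ (1 - α))
    {l : ℝ} (hl0 : 0 ≤ l) (hl1 : l ≤ 1) :
    ∫⁻ u, eexp (l * V (eulerStep b₀ σ₀ Δ y u) ^ α) ∂μ
      ≤ eexp (l * (1 + (α * Real.sqrt (CV * Cb)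
            + β * Cσ * α ^ 2 * (1 + 2 * η * Δ) ^ 2 * (CV + Cb) + α * η * Cb * Δ) * Δ) * V y ^ α)
        * (∫⁻ u, eexp (2 * (l * (α * η * Cσ * Δ) * ‖u‖ ^ 2)) ∂μ) ^ (1 / 2 : ℝ) := by
  have hv := hpos y
  set w := (Real.sqrt Δ * (α * V y ^ (α - 1))) • (gradient V y + (2 * η * Δ) • b₀ y) with hw
  set D := Δ * α ^ 2 * Cσ * (1 + 2 * η * Δ) ^ 2 * (CV + Cb) * V y ^ α with hD
  have hD0 : 0 < D := by positivity
  have hc := continuous_matrixAct (σ₀ y)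
  have hlip : ∀ u u', |⟪w, matrixAct (σ₀ y) u⟫ - ⟪w, matrixAct (σ₀ y) u'⟫|
      ≤ Real.sqrt D * ‖u - u'‖ := by
    intro u u'
    rw [← inner_sub_right, ← matrixAct_sub_right]
    refine (abs_real_inner_le_norm _ _).trans ?_
    calc ‖w‖ * ‖matrixAct (σ₀ y) (u - u')‖
        ≤ ‖w‖ * (frobeniusNorm (σ₀ y) * ‖u - u'‖) := by gcongr; exact norm_matrixAct_le _ _
      _ = ‖w‖ * frobeniusNorm (σ₀ y) * ‖u - u'‖ := by ring
      _ ≤ _ := by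
        gcongr
        exact Real.le_sqrt_of_sq_le (norm_noise_coefficient_sq_le hpos hgrad hη hΔ.le hCV.le hCb.le
          b₀ σ₀ y hb hσ)
  have hgc := hGC.lintegral_eexp_le (Real.sqrt_pos.mpr hD0) hlip (l := 2 * l) (by positivity)
  rw [(hμ.integral_inner_matrixAct (σ₀ y) w).2, mul_zero, zero_add, mul_pow,
    Real.sq_sqrt hD0.le] at hgc
  set Q := V y ^ α * (1 + α * (Real.sqrt (CV * Cb) + η * Cb * Δ) * Δ) with hQ
  calc ∫⁻ u, eexp (l * V (eulerStep b₀ σ₀ Δ y u) ^ α) ∂μ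
      ≤ ∫⁻ u, eexp (l * Q) * eexp (l * ⟪w, matrixAct (σ₀ y) u⟫
          + l * (α * η * Cσ * Δ) * ‖u‖ ^ 2) ∂μ := by
        refine lintegral_mono fun u => ?_
        rw [← eexp_add]
        refine eexp_le_eexp ?_
        have := mul_le_mul_of_nonneg_left (rpow_eulerStep_le hV hpos hgrad hess hη hΔ.le hα0.le
          hα1 hCV.le hCb.le b₀ σ₀ y hb hσ u) hl0
        rw [← hw, ← hQ] at this
        linarith
    _ = eexp (l * Q) * ∫⁻ u, eexp (l * ⟪w, matrixAct (σ₀ y) u⟫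
          + l * (α * η * Cσ * Δ) * ‖u‖ ^ 2) ∂μ :=
        lintegral_const_mul' _ _ (eexp_ne_top _)
    _ ≤ eexp (l * Q) * ((∫⁻ u, eexp (2 * (l * ⟪w, matrixAct (σ₀ y) u⟫)) ∂μ) ^ (1 / 2 : ℝ)
          * (∫⁻ u, eexp (2 * (l * (α * η * Cσ * Δ) * ‖u‖ ^ 2)) ∂μ) ^ (1 / 2 : ℝ)) := by
        gcongr
        exact lintegral_eexp_add_le (by fun_prop) (by fun_prop)
    _ ≤ eexp (l * Q) * (eexp (β * ((2 * l) ^ 2 * D) / 4) ^ (1 / 2 : ℝ)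
          * (∫⁻ u, eexp (2 * (l * (α * η * Cσ * Δ) * ‖u‖ ^ 2)) ∂μ) ^ (1 / 2 : ℝ)) := by
        gcongr
        simpa only [mul_assoc] using hgc
    _ ≤ _ := by
        rw [eexp_rpow, ← mul_assoc, ← eexp_add]
        gcongr
        refine eexp_le_eexp ?_
        -- The concentration cost is quadratic in l. The restriction l ≤ 1 makes it linear, so it
        -- becomes part of the growth factor 1 + CΔ.
        have h1 : l ^ 2 * (β * D) ≤ l * (β * D) :=
          mul_le_mul_of_nonneg_right (by nlinarith) (by positivity)
        have h2 : 0 ≤ l * (β * D) := by positivity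
        have h3 : l * (1 + (α * Real.sqrt (CV * Cb)
            + β * Cσ * α ^ 2 * (1 + 2 * η * Δ) ^ 2 * (CV + Cb) + α * η * Cb * Δ) * Δ) * V y ^ α
            = l * Q + l * (β * D) := by rw [hQ, hD]; ring
        rw [h3]
        linarith

end Lyapunov

/-! ### Elementary properties of the parameters -/

namespace Params

variable {p : Params}

theorem Valid.Δ_pos (hp : p.Valid) : 0 < p.Δ :=
  div_pos hp.T_pos (by exact_mod_cast hp.N_pos)

theorem Valid.N_mul_Δ (hp : p.Valid) : p.N * p.Δ = p.T := by
  have : (p.N : ℝ) ≠ 0 := by exact_mod_cast hp.N_pos.ne'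
  rw [Params.Δ]
  field_simp

theorem Valid.time_mem (hp : p.Valid) {k : ℕ} (hk : k < p.N) :
    (k : ℝ) * p.Δ ∈ Set.Icc 0 p.T := by
  refine ⟨mul_nonneg k.cast_nonneg hp.Δ_pos.le, ?_⟩
  rw [← hp.N_mul_Δ]
  exact mul_le_mul_of_nonneg_right (by exact_mod_cast hk.le) hp.Δ_pos.le

theorem Valid.α_pos (hp : p.Valid) : 0 < p.α := by linarith [hp.α_ge]

theorem Valid.lipConst_pos (hp : p.Valid) : 0 < p.lipConst := by
  have h1 := hp.Lb_nonneg
  have h2 := hp.Lσ_nonneg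
  have h3 := hp.Lip_pos
  have h4 := hp.Δ_pos
  rw [lipConst]
  rcases h1.eq_or_lt with h | h
  · have : 0 < p.Lσ := by linarith
    positivity
  · positivity

theorem Valid.φ_pos (hp : p.Valid) : 0 < p.φ := by
  have := hp.lipConst_pos
  have := hp.Δ_pos
  have := hp.Cσ_pos
  have := hp.β_pos
  rw [φ]
  positivity

theorem Valid.C_nonneg (hp : p.Valid) (hη : 0 ≤ p.η) : 0 ≤ p.C := by
  have := hp.Δ_pos
  have := hp.Cσ_pos
  have := hp.CV_pos
  have := hp.Cb_pos
  have := hp.β_pos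
  have := hp.α_pos
  rw [C]
  positivity

theorem Dominated.η_nonneg {d q : ℕ}
    {b : ℝ → EuclideanSpace ℝ (Fin d) → EuclideanSpace ℝ (Fin d)}
    {σ : ℝ → EuclideanSpace ℝ (Fin d) → Matrix (Fin d) (Fin q) ℝ}
    {V : EuclideanSpace ℝ (Fin d) → ℝ} (h : p.Dominated b σ V) : 0 ≤ p.η := by
  have := (ContinuousLinearMap.opNorm_nonneg _).trans (h.hess 0)
  linarith

theorem Valid.sum_weights_le (hp : p.Valid) :
    p.β * p.Cσ * p.Δ * ∑ j ∈ Finset.range p.N, (1 + p.lipConst * p.Δ) ^ j ≤ p.φ := by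
  have hc := hp.lipConst_pos
  have hΔ := hp.Δ_pos
  have hβ := hp.β_pos
  have hCσ := hp.Cσ_pos
  set c := p.lipConst with hcdef
  have hcΔ : 0 < c * p.Δ := by positivity
  have hsum : (∑ j ∈ Finset.range p.N, (1 + c * p.Δ) ^ j) * (c * p.Δ)
      = (1 + c * p.Δ) ^ p.N - 1 := by
    have := geom_sum_mul (1 + c * p.Δ) p.N
    rwa [add_sub_cancel_left] at this
  set y := Real.exp (c * p.T) with hy
  have hy1 : 1 ≤ y := Real.one_le_exp (mul_nonneg hc.le hp.T_pos.le)
  have hpow : (1 + c * p.Δ) ^ p.N ≤ y := by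
    calc (1 + c * p.Δ) ^ p.N ≤ Real.exp (c * p.Δ) ^ p.N :=
          pow_le_pow_left₀ (by positivity) (by linarith [Real.add_one_le_exp (c * p.Δ)]) _
      _ = y := by
          rw [← Real.exp_nat_mul, hy, ← hp.N_mul_Δ]
          congr 1
          ring
  -- This elementary inequality, with y = e^{C(Δ)T}, accounts for the factor e^{3C(Δ)T}/4 in φ.
  have hcube : 4 * (y - 1) ≤ y ^ 3 := by
    nlinarith [sq_nonneg (y - 1), mul_nonneg (sub_nonneg.mpr hy1) (sq_nonneg (y - 1)),
      sq_nonneg (3 * (y - 1) - 1 / 2)]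
  have e3 : Real.exp (3 * c * p.T) = y ^ 3 := by
    rw [hy, ← Real.exp_nat_mul]
    congr 1
    push_cast
    ring
  have hG : p.Δ * ∑ j ∈ Finset.range p.N, (1 + c * p.Δ) ^ j ≤ (y - 1) / c := by
    rw [le_div_iff₀ hc]
    linarith
  rw [φ, ← hcdef, e3]
  calc p.β * p.Cσ * p.Δ * ∑ j ∈ Finset.range p.N, (1 + c * p.Δ) ^ j
      = p.β * p.Cσ * (p.Δ * ∑ j ∈ Finset.range p.N, (1 + c * p.Δ) ^ j) := by ring
    _ ≤ p.β * p.Cσ * ((y - 1) / c) := by gcongr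
    _ = p.β * p.Cσ * (1 / (4 * c)) * (4 * (y - 1)) := by field_simp
    _ ≤ p.β * p.Cσ * (1 / (4 * c)) * y ^ 3 := by gcongr
    _ ≤ p.β * p.Cσ * ((1 + c * p.Δ) / (4 * c)) * y ^ 3 := by
        gcongr
        linarith
    _ = _ := by ring

theorem Valid.one_add_C_mul_Δ_pow_le (hp : p.Valid) (hη : 0 ≤ p.η) :
    (1 + p.C * p.Δ) ^ p.N ≤ Real.exp (p.C * p.T) := by
  have hC := hp.C_nonneg hη
  have hΔ := hp.Δ_pos
  calc (1 + p.C * p.Δ) ^ p.N ≤ Real.exp (p.C * p.Δ) ^ p.N :=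
        pow_le_pow_left₀ (by positivity) (by linarith [Real.add_one_le_exp (p.C * p.Δ)]) _
    _ = _ := by
        rw [← Real.exp_nat_mul, ← hp.N_mul_Δ]
        congr 1
        ring

end Params

/-! ### One step: Lipschitz functions and the Lyapunov function together -/

section OneStep

variable {d q : ℕ} {μ : Measure (EuclideanSpace ℝ (Fin q))} [IsProbabilityMeasure μ]
  {p : Params} {b : ℝ → EuclideanSpace ℝ (Fin d) → EuclideanSpace ℝ (Fin d)}
  {σ : ℝ → EuclideanSpace ℝ (Fin d) → Matrix (Fin d) (Fin q) ℝ}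
  {V : EuclideanSpace ℝ (Fin d) → ℝ}

/-- One step carries the fraction Δ = T/N of the exponent, so Jensen turns a bound e^m at horizon T
into e^{m/N} per step, and the product over N steps is independent of N. -/
theorem lintegral_eexp_norm_sq_step_le (hp : p.Valid) (hη : 0 ≤ p.η) {l r m : ℝ}
    (hlr : l ≤ r)
    (hm : ∫⁻ u, eexp (r * (2 * p.η * p.α * p.Cσ * p.T) * ‖u‖ ^ 2) ∂μ ≤ eexp m) :
    ∫⁻ u, eexp (2 * (l * (p.α * p.η * p.Cσ * p.Δ) * ‖u‖ ^ 2)) ∂μ ≤ eexp (m / p.N) := by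
  have hα := hp.α_pos
  have hΔ := hp.Δ_pos
  have hCσ := hp.Cσ_pos
  have hN : (0 : ℝ) < p.N := by exact_mod_cast hp.N_pos
  have hN1 : (1 : ℝ) ≤ p.N := by exact_mod_cast hp.N_pos
  calc ∫⁻ u, eexp (2 * (l * (p.α * p.η * p.Cσ * p.Δ) * ‖u‖ ^ 2)) ∂μ
      ≤ ∫⁻ u, eexp (r * (2 * p.η * p.α * p.Cσ * p.T) * ‖u‖ ^ 2 * (1 / p.N)) ∂μ := by
        refine lintegral_mono fun u => eexp_le_eexp ?_
        have h1 : l * (2 * (p.α * p.η * p.Cσ * p.Δ) * ‖u‖ ^ 2)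
            ≤ r * (2 * (p.α * p.η * p.Cσ * p.Δ) * ‖u‖ ^ 2) :=
          mul_le_mul_of_nonneg_right hlr (by positivity)
        have h2 : r * (2 * p.η * p.α * p.Cσ * p.T) * ‖u‖ ^ 2 * (1 / p.N)
            = r * (2 * (p.α * p.η * p.Cσ * p.Δ) * ‖u‖ ^ 2) := by
          rw [← hp.N_mul_Δ]
          field_simp
        rw [h2]
        linarith
    _ ≤ (∫⁻ u, eexp (r * (2 * p.η * p.α * p.Cσ * p.T) * ‖u‖ ^ 2) ∂μ) ^ (1 / p.N : ℝ) :=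
        lintegral_eexp_mul_le (by fun_prop) (by positivity) ((div_le_one hN).mpr hN1)
    _ ≤ eexp m ^ (1 / p.N : ℝ) := by gcongr
    _ = _ := by rw [eexp_rpow]; congr 1; ring

/-- Cauchy–Schwarz separates the Lipschitz function from the Lyapunov term; the factor 1/2 in front
of l V^α is there so that the squared factor is exactly exp(l V^α). A second Cauchy–Schwarz, inside
the Lyapunov estimate, explains m/(4N). -/
theorem lintegral_eexp_lipschitz_add_rpow_eulerStep_le (hμ : IsStandardized μ) (hp : p.Valid)
    (hGC : GaussianConcentration μ p.β) (hHS : p.Smooth b σ) (hHD : p.Dominated b σ V)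
    {s : ℝ} (hs : s ∈ Set.Icc 0 p.T) {g : EuclideanSpace ℝ (Fin d) → ℝ} {K : ℝ} (hK : 0 < K)
    (hg : ∀ y z, |g y - g z| ≤ K * ‖y - z‖) {t l r m : ℝ} (ht : 0 ≤ t) (hl : 0 ≤ l)
    (hlr : l ≤ r) (hr : r ≤ 1)
    (hm : ∫⁻ u, eexp (r * (2 * p.η * p.α * p.Cσ * p.T) * ‖u‖ ^ 2) ∂μ ≤ eexp m)
    (y : EuclideanSpace ℝ (Fin d)) :
    ∫⁻ u, eexp (t * g (eulerStep (b s) (σ s) p.Δ y u)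
        + 1 / 2 * (l * V (eulerStep (b s) (σ s) p.Δ y u) ^ p.α)) ∂μ
      ≤ eexp (t * ∫ u, g (eulerStep (b s) (σ s) p.Δ y u) ∂μ
        + 1 / 2 * (p.β * (t * K) ^ 2 * p.Δ * p.Cσ * V y ^ (1 - p.α)
          + l * (1 + p.C * p.Δ) * V y ^ p.α) + m / (4 * p.N)) := by
  have hα := hp.α_pos
  have hΔ := hp.Δ_pos
  have hCσ := hp.Cσ_pos
  have hv := hHD.pos y
  have hη := hHD.η_nonneg
  have hσ2 : frobeniusNorm (σ s y) ^ 2 ≤ p.Cσ * V y ^ (1 - p.α) := by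
    rw [frobeniusNorm_sq_eq_trace]
    exact hHD.σ_le s hs y
  have hcont : Continuous fun u => eulerStep (b s) (σ s) p.Δ y u :=
    (continuous_eulerStep (hHS.b_lip s hs) (hHS.σ_lip s hs)).comp
      (continuous_const.prodMk continuous_id)
  have hgc : Continuous g := continuous_of_norm_sub_le hg
  have hVc : Continuous V := hHD.contDiff.continuous
  set D := p.Δ * (p.Cσ * V y ^ (1 - p.α)) with hD
  have hD0 : 0 < D := by positivity
  have hlip : ∀ u u', |g (eulerStep (b s) (σ s) p.Δ y u) - g (eulerStep (b s) (σ s) p.Δ y u')|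
      ≤ K * Real.sqrt D * ‖u - u'‖ := by
    intro u u'
    refine (hg _ _).trans ?_
    rw [mul_assoc]
    refine mul_le_mul_of_nonneg_left ((lipschitz_eulerStep_right y u u').trans ?_) hK.le
    refine mul_le_mul_of_nonneg_right ?_ (norm_nonneg _)
    refine Real.le_sqrt_of_sq_le ?_
    rw [mul_pow, Real.sq_sqrt hΔ.le]
    exact mul_le_mul_of_nonneg_left hσ2 hΔ.le
  have h1 := hGC.lintegral_eexp_le (mul_pos hK (Real.sqrt_pos.mpr hD0)) hlip
    (l := 2 * t) (by positivity)
  have h2 := lintegral_eexp_rpow_eulerStep_le hμ hp.β_pos.le hGC hHD.contDiff hHD.pos hHD.grad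
    hHD.hess hη hΔ hα hp.α_le hp.CV_pos hp.Cb_pos hCσ (b s) (σ s) y (hHD.b_le s hs y) hσ2 hl
    (hlr.trans hr)
  have h3 := lintegral_eexp_norm_sq_step_le hp hη hlr hm
  have hmeasV : Measurable fun u => V (eulerStep (b s) (σ s) p.Δ y u) ^ p.α :=
    (hVc.comp hcont).measurable.pow_const _
  calc _ ≤ _ := lintegral_eexp_add_le
        ((hgc.comp hcont).measurable.const_mul t).aemeasurable
        ((hmeasV.const_mul l).const_mul (1 / 2)).aemeasurable
    _ ≤ eexp (2 * t * ∫ u, g (eulerStep (b s) (σ s) p.Δ y u) ∂μ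
          + p.β * (2 * t * (K * Real.sqrt D)) ^ 2 / 4) ^ (1 / 2 : ℝ)
        * (eexp (l * (1 + p.C * p.Δ) * V y ^ p.α) * eexp (m / p.N) ^ (1 / 2 : ℝ))
          ^ (1 / 2 : ℝ) := by
        gcongr ?_ ^ _ * ?_ ^ _
        · simpa only [mul_assoc, Function.comp] using h1
        · have e : ∀ a : ℝ, 2 * (1 / 2 * a) = a := fun a => by ring
          simp_rw [e]
          refine h2.trans ?_
          rw [← Params.C]
          gcongr
    _ = _ := by
        rw [eexp_rpow, eexp_rpow, ← eexp_add, eexp_rpow, ← eexp_add]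
        congr 1
        rw [mul_pow, mul_pow, mul_pow, Real.sq_sqrt hD0.le, hD]
        ring

theorem abs_integral_eulerStep_sub_le (hμ : IsStandardized μ) (hp : p.Valid)
    (hGC : GaussianConcentration μ p.β) (hHS : p.Smooth b σ)
    {s : ℝ} (hs : s ∈ Set.Icc 0 p.T) {g : EuclideanSpace ℝ (Fin d) → ℝ} {K : ℝ} (hK : 0 < K)
    (hg : ∀ y z, |g y - g z| ≤ K * ‖y - z‖) (y z : EuclideanSpace ℝ (Fin d)) :
    |∫ u, g (eulerStep (b s) (σ s) p.Δ y u) ∂μ - ∫ u, g (eulerStep (b s) (σ s) p.Δ z u) ∂μ|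
      ≤ K * Real.sqrt (1 + p.lipConst * p.Δ) * ‖y - z‖ := by
  obtain ⟨i, h⟩ := integral_norm_eulerStep_sub_le (Lb := p.Lb) (Lσ := p.Lσ) hμ hp.Δ_pos.le
    hp.Lb_nonneg (hHS.b_lip s hs) (hHS.σ_lip s hs) y z
  have hgi : ∀ y, Integrable (fun u => g (eulerStep (b s) (σ s) p.Δ y u)) μ := by
    intro y
    -- The added 1 keeps the Lipschitz constant positive where σ vanishes.
    refine (hGC.of_lipschitz (K := K * (Real.sqrt p.Δ * frobeniusNorm (σ s y) + 1)) ?_ ?_).1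
    · have := frobeniusNorm_nonneg (σ s y)
      positivity
    · intro u u'
      refine (hg _ _).trans ?_
      rw [mul_assoc]
      refine mul_le_mul_of_nonneg_left ((lipschitz_eulerStep_right y u u').trans ?_) hK.le
      exact mul_le_mul_of_nonneg_right (by linarith) (norm_nonneg _)
  rw [← integral_sub (hgi y) (hgi z)]
  calc _ ≤ ∫ u, |g (eulerStep (b s) (σ s) p.Δ y u) - g (eulerStep (b s) (σ s) p.Δ z u)| ∂μ :=
        abs_integral_le_integral_abs
    _ ≤ ∫ u, K * ‖eulerStep (b s) (σ s) p.Δ y u - eulerStep (b s) (σ s) p.Δ z u‖ ∂μ :=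
        integral_mono ((hgi y).sub (hgi z)).abs (i.const_mul K) fun u => hg _ _
    _ ≤ _ := by
        rw [integral_const_mul, mul_assoc]
        exact mul_le_mul_of_nonneg_left h hK.le

end OneStep

/-! ### The law of the scheme -/

section Law

variable {d q : ℕ} {Ω : Type*} {U : ℕ → Ω → EuclideanSpace ℝ (Fin q)} {p : Params} {b : ℝ → EuclideanSpace ℝ (Fin d) → EuclideanSpace ℝ (Fin d)}
  {σ : ℝ → EuclideanSpace ℝ (Fin d) → Matrix (Fin d) (Fin q) ℝ}

theorem eulerScheme_succ (Δ : ℝ) (x : EuclideanSpace ℝ (Fin d)) (k : ℕ) (ω : Ω) :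
    eulerScheme b σ Δ x U (k + 1) ω
      = eulerStep (b (k * Δ)) (σ (k * Δ)) Δ (eulerScheme b σ Δ x U k ω) (U k ω) := rfl

/-- The position after k steps depends only on the innovations with indices below k, whence its
independence of `U k`. -/
theorem exists_measurable_eulerScheme_eq (hp : p.Valid) (hHS : p.Smooth b σ)
    (x : EuclideanSpace ℝ (Fin d)) (U : ℕ → Ω → EuclideanSpace ℝ (Fin q)) {k : ℕ}
    (hk : k ≤ p.N) :
    ∃ F : (Finset.range k → EuclideanSpace ℝ (Fin q)) → EuclideanSpace ℝ (Fin d),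
      Measurable F ∧ ∀ ω, eulerScheme b σ p.Δ x U k ω = F fun i => U i ω := by
  induction k with
  | zero => exact ⟨fun _ => x, measurable_const, fun ω => rfl⟩
  | succ k ih =>
    obtain ⟨F, hF, hF'⟩ := ih (by omega)
    have hs := hp.time_mem (k := k) (by omega)
    have hc := continuous_eulerStep (Δ := p.Δ) (hHS.b_lip _ hs) (hHS.σ_lip _ hs)
    refine ⟨fun v => eulerStep (b (k * p.Δ)) (σ (k * p.Δ)) p.Δ
      (F fun i => v ⟨i, Finset.range_mono (Nat.le_succ k) i.2⟩)
      (v ⟨k, Finset.self_mem_range_succ k⟩), ?_, fun ω => ?_⟩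
    · have h1 : Measurable fun v : Finset.range (k + 1) → EuclideanSpace ℝ (Fin q) =>
          F fun i => v ⟨i, Finset.range_mono (Nat.le_succ k) i.2⟩ :=
        hF.comp (measurable_pi_lambda _ fun i => measurable_pi_apply _)
      exact hc.measurable.comp (h1.prodMk (measurable_pi_apply _))
    · rw [eulerScheme_succ, hF']

variable [MeasurableSpace Ω] {P : Measure Ω} {μ : Measure (EuclideanSpace ℝ (Fin q))}

theorem aemeasurable_eulerScheme (hU : ∀ i, AEMeasurable (U i) P) (hp : p.Valid)
    (hHS : p.Smooth b σ) (x : EuclideanSpace ℝ (Fin d)) {k : ℕ} (hk : k ≤ p.N) :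
    AEMeasurable (eulerScheme b σ p.Δ x U k) P := by
  obtain ⟨F, hF, hF'⟩ := exists_measurable_eulerScheme_eq hp hHS x U hk
  rw [funext hF']
  exact hF.comp_aemeasurable (aemeasurable_pi_lambda _ fun i => hU i)

/-- The transition of the scheme: the law after one more step. -/
theorem map_eulerScheme_succ [IsProbabilityMeasure P] (hU_indep : iIndepFun U P) (hU_law : ∀ i, HasLaw (U i) μ P)
    (hp : p.Valid) (hHS : p.Smooth b σ) (x : EuclideanSpace ℝ (Fin d)) {k : ℕ} (hk : k < p.N) :
    P.map (eulerScheme b σ p.Δ x U (k + 1))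
      = ((P.map (eulerScheme b σ p.Δ x U k)).prod μ).map
        (fun z => eulerStep (b (k * p.Δ)) (σ (k * p.Δ)) p.Δ z.1 z.2) := by
  have hU : ∀ i, AEMeasurable (U i) P := fun i => (hU_law i).aemeasurable
  have hX := aemeasurable_eulerScheme hU hp hHS x hk.le
  have hind : IndepFun (eulerScheme b σ p.Δ x U k) (U k) P := by
    obtain ⟨F, hF, hF'⟩ := exists_measurable_eulerScheme_eq hp hHS x U hk.le
    have h := hU_indep.indepFun_finset₀ (Finset.range k) {k} (by simp) hU
    have h2 := h.comp hF
      (measurable_pi_apply (⟨k, Finset.mem_singleton_self k⟩ : ({k} : Finset ℕ)))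
    rw [funext hF']
    exact h2
  have hs := hp.time_mem hk
  have hc := continuous_eulerStep (Δ := p.Δ) (hHS.b_lip _ hs) (hHS.σ_lip _ hs)
  rw [← (hU_law k).map_eq, ← (indepFun_iff_map_prod_eq_prod_map_map hX (hU k)).mp hind,
    AEMeasurable.map_map_of_aemeasurable hc.measurable.aemeasurable (hX.prodMk (hU k))]
  rfl

theorem integrable_norm_map_eulerScheme [IsProbabilityMeasure P]
    [IsProbabilityMeasure μ] (hμ : IsStandardized μ)
    (hU_indep : iIndepFun U P) (hU_law : ∀ i, HasLaw (U i) μ P)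
    (hp : p.Valid) (hHS : p.Smooth b σ) (x : EuclideanSpace ℝ (Fin d)) {k : ℕ} (hk : k ≤ p.N) :
    Integrable (fun y => ‖y‖) (P.map (eulerScheme b σ p.Δ x U k)) := by
  induction k with
  | zero =>
    have : eulerScheme b σ p.Δ x U 0 = fun _ => x := rfl
    rw [this, Measure.map_const, measure_univ, one_smul]
    exact integrable_dirac (by simp)
  | succ k ih =>
    have hs := hp.time_mem (k := k) (by omega)
    have hc := continuous_eulerStep (Δ := p.Δ) (hHS.b_lip _ hs) (hHS.σ_lip _ hs)
    have hX := aemeasurable_eulerScheme (fun i => (hU_law i).aemeasurable) hp hHS x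
      (k := k) (by omega)
    have : IsProbabilityMeasure (P.map (eulerScheme b σ p.Δ x U k)) :=
      Measure.isProbabilityMeasure_map hX
    rw [map_eulerScheme_succ hU_indep hU_law hp hHS x (by omega),
      integrable_map_measure (by fun_prop) hc.measurable.aemeasurable]
    set s := (k : ℝ) * p.Δ
    have hLb := hp.Lb_nonneg
    have hLσ := hp.Lσ_nonneg
    have hΔ := hp.Δ_pos
    have i1 := (ih (by omega)).comp_fst μ
    have i2 := hμ.integrable_norm.comp_snd (P.map (eulerScheme b σ p.Δ x U k))
    have i3 := (ih (by omega)).mul_prod hμ.integrable_norm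
    refine ((((integrable_const (p.Δ * ‖b s 0‖)).add (i1.const_mul (1 + p.Δ * p.Lb))).add
      (i2.const_mul (Real.sqrt p.Δ * frobeniusNorm (σ s 0)))).add
      (i3.const_mul (Real.sqrt p.Δ * p.Lσ))).mono' (by fun_prop) ?_
    filter_upwards with z
    obtain ⟨y, u⟩ := z
    simp only [Function.comp, norm_norm, Pi.add_apply]
    have h1 : ‖b s y‖ ≤ ‖b s 0‖ + p.Lb * ‖y‖ := by
      have := hHS.b_lip s hs y 0
      rw [sub_zero] at this
      linarith [norm_sub_norm_le (b s y) (b s 0)]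
    have h2 : ‖matrixAct (σ s y) u‖ ≤ frobeniusNorm (σ s 0) * ‖u‖ + p.Lσ * (‖y‖ * ‖u‖) := by
      have e : matrixAct (σ s y) u = matrixAct (σ s 0) u + matrixAct (σ s y - σ s 0) u := by
        rw [matrixAct_sub_left]; abel
      rw [e]
      refine (norm_add_le _ _).trans (add_le_add (norm_matrixAct_le _ _)
        ((norm_matrixAct_le _ _).trans ?_))
      have := hHS.σ_lip s hs y 0
      rw [sub_zero] at this
      rw [← mul_assoc]
      gcongr
    calc ‖eulerStep (b s) (σ s) p.Δ y u‖
        ≤ ‖y‖ + p.Δ * ‖b s y‖ + Real.sqrt p.Δ * ‖matrixAct (σ s y) u‖ := by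
          rw [eulerStep]
          refine (norm_add₃_le).trans (le_of_eq ?_)
          rw [norm_smul, norm_smul, Real.norm_of_nonneg hΔ.le,
            Real.norm_of_nonneg (Real.sqrt_nonneg _)]
      _ ≤ ‖y‖ + p.Δ * (‖b s 0‖ + p.Lb * ‖y‖) + Real.sqrt p.Δ
            * (frobeniusNorm (σ s 0) * ‖u‖ + p.Lσ * (‖y‖ * ‖u‖)) := by gcongr
      _ = _ := by ring

end Law

/-! ### Backward induction for the Laplace transform -/

section Core

variable {d q : ℕ} {Ω : Type*} [MeasurableSpace Ω] {P : Measure Ω} [IsProbabilityMeasure P]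
  {U : ℕ → Ω → EuclideanSpace ℝ (Fin q)}
  {μ : Measure (EuclideanSpace ℝ (Fin q))} [IsProbabilityMeasure μ]
  {p : Params} {b : ℝ → EuclideanSpace ℝ (Fin d) → EuclideanSpace ℝ (Fin d)}
  {σ : ℝ → EuclideanSpace ℝ (Fin d) → Matrix (Fin d) (Fin q) ℝ}
  {V : EuclideanSpace ℝ (Fin d) → ℝ}

theorem integrable_of_lipschitz {E : Type*} [SeminormedAddCommGroup E] [MeasurableSpace E]
    [BorelSpace E] [SecondCountableTopology E]
    {m : Measure E} [IsFiniteMeasure m] (hm : Integrable (fun y => ‖y‖) m) {g : E → ℝ} {K : ℝ}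
    (hg : ∀ y z, |g y - g z| ≤ K * ‖y - z‖) : Integrable g m := by
  refine ((integrable_const |g 0|).add (hm.const_mul K)).mono'
    (continuous_of_norm_sub_le hg).aestronglyMeasurable ?_
  filter_upwards with y
  have := hg y 0
  rw [sub_zero] at this
  calc |g y| = |g 0 + (g y - g 0)| := by ring_nf
    _ ≤ |g 0| + |g y - g 0| := abs_add_le _ _
    _ ≤ |g 0| + K * ‖y‖ := by linarith

/-- Conditioning on the last step replaces g by its average g', K by K (1 + C(Δ)Δ)^{1/2}, and
creates a charge w ρ V^{1-α}, absorbed through `hAc` as A w + c w V^α. Here s is the sum of all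
charges w still to come, and l + c s is the budget: it grows by at most 1 + CΔ per step, so the
bound by r keeps every intermediate l below r. The statement is uniform in g, K and l because all
three change at each step. -/
theorem lintegral_eexp_map_eulerScheme_le (hU_indep : iIndepFun U P)
    (hU_law : ∀ i, HasLaw (U i) μ P) (hμ : IsStandardized μ) (hp : p.Valid)
    (hGC : GaussianConcentration μ p.β) (hHS : p.Smooth b σ) (hHD : p.Dominated b σ V)
    (x : EuclideanSpace ℝ (Fin d)) {t A c ρ r m : ℝ} (ht : 0 ≤ t) (hc : 0 ≤ c)
    (hρ : 0 < ρ) (hAc : ∀ y, ρ * V y ^ (1 - p.α) ≤ A + c * V y ^ p.α) (hr : r ≤ 1)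
    (hm : ∫⁻ u, eexp (r * (2 * p.η * p.α * p.Cσ * p.T) * ‖u‖ ^ 2) ∂μ ≤ eexp m)
    (k : ℕ) (hk : k ≤ p.N) :
    ∀ (g : EuclideanSpace ℝ (Fin d) → ℝ) (K : ℝ), 0 < K → (∀ y z, |g y - g z| ≤ K * ‖y - z‖) →
    ∀ l s : ℝ, 0 ≤ l → s = p.β * (t * K) ^ 2 * p.Δ * p.Cσ / ρ
        * ∑ j ∈ Finset.range k, (1 + p.lipConst * p.Δ) ^ j →
      (l + c * s) * (1 + p.C * p.Δ) ^ k ≤ r →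
      ∫⁻ y, eexp (t * g y + 1 / 2 * (l * V y ^ p.α)) ∂(P.map (eulerScheme b σ p.Δ x U k))
        ≤ eexp (t * ∫ y, g y ∂(P.map (eulerScheme b σ p.Δ x U k))
          + 1 / 2 * (A * s + (l + c * s) * (1 + p.C * p.Δ) ^ k * V x ^ p.α)
          + k * (m / (4 * p.N))) := by
  have hVc : Continuous V := hHD.contDiff.continuous
  have hΔ := hp.Δ_pos
  have hCσ := hp.Cσ_pos
  have hβ := hp.β_pos
  have hlip := hp.lipConst_pos
  have hCΔ : 0 ≤ p.C * p.Δ := mul_nonneg (hp.C_nonneg hHD.η_nonneg) hΔ.le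
  induction k with
  | zero =>
    intro g K hK hg l s hl hs hlr
    have : eulerScheme b σ p.Δ x U 0 = fun _ => x := rfl
    have hs0 : s = 0 := by rw [hs]; simp
    rw [this, Measure.map_const, measure_univ, one_smul, lintegral_dirac, integral_dirac, hs0]
    simp
  | succ k ih =>
    intro g K hK hg l s hl hs hlr
    have htime := hp.time_mem (k := k) (by omega)
    have hcont := continuous_eulerStep (Δ := p.Δ) (hHS.b_lip _ htime) (hHS.σ_lip _ htime)
    have hX := aemeasurable_eulerScheme (fun i => (hU_law i).aemeasurable) hp hHS x
      (k := k) (by omega)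
    have hprob : IsProbabilityMeasure (P.map (eulerScheme b σ p.Δ x U k)) :=
      Measure.isProbabilityMeasure_map hX
    have hX' := aemeasurable_eulerScheme (fun i => (hU_law i).aemeasurable) hp hHS x hk
    have hprob' : IsProbabilityMeasure (P.map (eulerScheme b σ p.Δ x U (k + 1))) :=
      Measure.isProbabilityMeasure_map hX'
    have hgc : Continuous g := continuous_of_norm_sub_le hg
    set a := 1 + p.lipConst * p.Δ with ha
    have ha0 : 0 < a := by positivity
    set w := p.β * (t * K) ^ 2 * p.Δ * p.Cσ / ρ with hw
    have hw0 : 0 ≤ w := by positivity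
    have hwρ : p.β * (t * K) ^ 2 * p.Δ * p.Cσ = w * ρ :=
      (div_mul_cancel₀ _ hρ.ne').symm
    set s' := w * a * ∑ j ∈ Finset.range k, a ^ j with hs'
    have hs'0 : 0 ≤ s' :=
      mul_nonneg (mul_nonneg hw0 ha0.le) (Finset.sum_nonneg fun _ _ => pow_nonneg ha0.le _)
    have hss' : s = w + s' := by
      have : ∑ j ∈ Finset.range k, a ^ (j + 1) = a * ∑ j ∈ Finset.range k, a ^ j := by
        rw [Finset.mul_sum]
        exact Finset.sum_congr rfl fun j _ => pow_succ' a j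
      -- The term j = 0 is the charge of the step being removed; the others are the charges for g',
      -- whose squared Lipschitz constant carries one extra factor a.
      rw [hs, Finset.sum_range_succ', pow_zero, this, hs']
      ring
    set l' := l * (1 + p.C * p.Δ) + w * c with hl'
    have hCΔ1 : 0 ≤ 1 + p.C * p.Δ := by linarith
    have hl'0 : 0 ≤ l' := add_nonneg (mul_nonneg hl hCΔ1) (mul_nonneg hw0 hc)
    have hgrow : l' + c * s' ≤ (l + c * s) * (1 + p.C * p.Δ) := by
      rw [hss', hl']
      nlinarith [mul_nonneg (mul_nonneg hc hw0) hCΔ, mul_nonneg (mul_nonneg hc hs'0) hCΔ]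
    have hpow : (l' + c * s') * (1 + p.C * p.Δ) ^ k
        ≤ (l + c * s) * (1 + p.C * p.Δ) ^ (k + 1) :=
      (mul_le_mul_of_nonneg_right hgrow (pow_nonneg hCΔ1 k)).trans_eq (by ring)
    have hlr0 : l ≤ r := by
      refine le_trans ?_ hlr
      have h1 : 1 ≤ (1 + p.C * p.Δ) ^ (k + 1) := one_le_pow₀ (by linarith)
      have h2 : l ≤ l + c * s := by rw [hss']; nlinarith [mul_nonneg hc (add_nonneg hw0 hs'0)]
      nlinarith
    set g' : EuclideanSpace ℝ (Fin d) → ℝ :=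
      fun y => ∫ u, g (eulerStep (b (k * p.Δ)) (σ (k * p.Δ)) p.Δ y u) ∂μ with hg'
    have hint : ∫ y, g y ∂(P.map (eulerScheme b σ p.Δ x U (k + 1)))
        = ∫ y, g' y ∂(P.map (eulerScheme b σ p.Δ x U k)) := by
      have hgi := integrable_of_lipschitz
        (integrable_norm_map_eulerScheme hμ hU_indep hU_law hp hHS x hk) hg
      rw [map_eulerScheme_succ hU_indep hU_law hp hHS x (by omega)] at hgi ⊢
      rw [integrable_map_measure hgc.aestronglyMeasurable hcont.measurable.aemeasurable] at hgi
      rw [integral_map hcont.measurable.aemeasurable hgc.aestronglyMeasurable]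
      exact integral_prod _ hgi
    have hKa : 0 < K * Real.sqrt a := by positivity
    have hih := ih (by omega) g' (K * Real.sqrt a) hKa
      (abs_integral_eulerStep_sub_le hμ hp hGC hHS htime hK hg) l' s' hl'0
      (by
        rw [hs', hw, ← mul_assoc t K, mul_pow (t * K), Real.sq_sqrt ha0.le]
        ring) (hpow.trans hlr)
    have hVm : Measurable fun y => V y ^ p.α := hVc.measurable.pow_const _
    have hmeas : Measurable fun y => eexp (t * g y + 1 / 2 * (l * V y ^ p.α)) :=
      measurable_eexp.comp
        ((hgc.measurable.const_mul t).add ((hVm.const_mul l).const_mul (1 / 2)))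
    have hmeas' : Measurable fun z : EuclideanSpace ℝ (Fin d) × EuclideanSpace ℝ (Fin q) =>
        eexp (t * g (eulerStep (b (k * p.Δ)) (σ (k * p.Δ)) p.Δ z.1 z.2)
          + 1 / 2 * (l * V (eulerStep (b (k * p.Δ)) (σ (k * p.Δ)) p.Δ z.1 z.2) ^ p.α)) :=
      hmeas.comp hcont.measurable
    rw [hint, map_eulerScheme_succ hU_indep hU_law hp hHS x (by omega),
      lintegral_map hmeas hcont.measurable,
      lintegral_prod _ hmeas'.aemeasurable]
    calc _ ≤ ∫⁻ y, eexp (t * g' y + 1 / 2 * (l' * V y ^ p.α)) * eexp (1 / 2 * (A * w)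
            + m / (4 * p.N)) ∂(P.map (eulerScheme b σ p.Δ x U k)) := by
          refine lintegral_mono fun y => (lintegral_eexp_lipschitz_add_rpow_eulerStep_le hμ hp hGC
            hHS hHD htime hK hg ht hl hlr0 hr hm y).trans ?_
          rw [← eexp_add]
          refine eexp_le_eexp ?_
          have h1 := mul_le_mul_of_nonneg_left (hAc y) hw0
          have h2 : p.β * (t * K) ^ 2 * p.Δ * p.Cσ * V y ^ (1 - p.α)
              = w * (ρ * V y ^ (1 - p.α)) := by rw [hwρ]; ring
          rw [h2, hl']
          linarith
      _ = (∫⁻ y, eexp (t * g' y + 1 / 2 * (l' * V y ^ p.α))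
            ∂(P.map (eulerScheme b σ p.Δ x U k))) * eexp (1 / 2 * (A * w) + m / (4 * p.N)) :=
          lintegral_mul_const' _ _ (eexp_ne_top _)
      _ ≤ _ := by
          refine (mul_le_mul_left hih _).trans ?_
          rw [← eexp_add]
          refine eexp_le_eexp ?_
          have h1 := mul_le_mul_of_nonneg_right hpow (Real.rpow_nonneg (hHD.pos x).le p.α)
          rw [hss'] at h1 ⊢
          push_cast
          linarith

/-- The Laplace transform of a Lipschitz function of the terminal value of the scheme. -/
theorem integral_exp_lipschitz_map_eulerScheme_le (hU_indep : iIndepFun U P)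
    (hU_law : ∀ i, HasLaw (U i) μ P) (hμ : IsStandardized μ) (hp : p.Valid)
    (hGC : GaussianConcentration μ p.β) (hHS : p.Smooth b σ) (hHD : p.Dominated b σ V)
    (x : EuclideanSpace ℝ (Fin d)) {t A c m : ℝ} (ht : 0 < t) (hA : 0 ≤ A) (hc : 0 ≤ c)
    (hAc : ∀ y, p.φ * t ^ 2 * V y ^ (1 - p.α) ≤ A + c * V y ^ p.α)
    (hr : c * Real.exp (p.C * p.T) ≤ 1)
    (hm : ∫⁻ u, eexp (c * Real.exp (p.C * p.T) * (2 * p.η * p.α * p.Cσ * p.T) * ‖u‖ ^ 2) ∂μ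
      ≤ eexp m)
    {f : EuclideanSpace ℝ (Fin d) → ℝ} (hf : LipschitzWith 1 f) :
    Integrable (fun y => Real.exp (t * f y)) (P.map (eulerScheme b σ p.Δ x U p.N)) ∧
    ∫ y, Real.exp (t * f y) ∂(P.map (eulerScheme b σ p.Δ x U p.N))
      ≤ Real.exp (t * ∫ y, f y ∂(P.map (eulerScheme b σ p.Δ x U p.N))
        + (1 / 2 * (A + c * Real.exp (p.C * p.T) * V x ^ p.α) + m / 4)) := by
  have hφ := hp.φ_pos
  have hΔ := hp.Δ_pos
  have hCσ := hp.Cσ_pos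
  have hβ := hp.β_pos
  have hlip := hp.lipConst_pos
  have hN : (0 : ℝ) < p.N := by exact_mod_cast hp.N_pos
  have hCΔ : 0 ≤ p.C * p.Δ := mul_nonneg (hp.C_nonneg hHD.η_nonneg) hΔ.le
  have hg : ∀ y z, |f y - f z| ≤ 1 * ‖y - z‖ := by
    intro y z
    have := hf.dist_le_mul y z
    rwa [Real.dist_eq, dist_eq_norm, NNReal.coe_one] at this
  -- The induction is run with K = 1, l = 0 and ρ = φ t². Dividing by φ t² normalises the total
  -- charge to at most 1.
  set s := p.β * (t * 1) ^ 2 * p.Δ * p.Cσ / (p.φ * t ^ 2)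
        * ∑ j ∈ Finset.range p.N, (1 + p.lipConst * p.Δ) ^ j with hs
  have hs0 : 0 ≤ s := by positivity
  have hs1 : s ≤ 1 := by
    have e : s = (p.β * p.Cσ * p.Δ * ∑ j ∈ Finset.range p.N, (1 + p.lipConst * p.Δ) ^ j) / p.φ := by
      rw [hs]
      field_simp
    rw [e]
    exact (div_le_one hφ).mpr hp.sum_weights_le
  have hcs : (0 + c * s) * (1 + p.C * p.Δ) ^ p.N ≤ c * Real.exp (p.C * p.T) := by
    rw [zero_add]
    have := hp.one_add_C_mul_Δ_pow_le hHD.η_nonneg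
    have h1 : c * s ≤ c := by nlinarith
    gcongr
  have h := lintegral_eexp_map_eulerScheme_le hU_indep hU_law hμ hp hGC hHS hHD x ht.le hc
    (by positivity) hAc hr hm p.N le_rfl f 1 one_pos hg 0 s le_rfl hs hcs
  simp only [zero_mul, mul_zero, add_zero] at h
  refine integrable_exp_and_integral_le
    (hf.continuous.measurable.const_mul t).aemeasurable (h.trans (eexp_le_eexp ?_))
  have h1 := mul_le_mul_of_nonneg_right hcs (Real.rpow_nonneg (hHD.pos x).le p.α)
  have h2 : A * s ≤ A := by nlinarith
  have h3 : (p.N : ℝ) * (m / (4 * p.N)) = m / 4 := by field_simp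
  rw [h3]
  linarith

end Core

/-! ### Square-exponential moments of the innovations -/

theorem GaussianConcentration.exists_integrable_exp_norm_sq {q : ℕ}
    {μ : Measure (EuclideanSpace ℝ (Fin q))} {β : ℝ} (hβ : 0 < β)
    (hGC : GaussianConcentration μ β) :
    ∃ ε : ℝ, 0 < ε ∧ Integrable (fun u => Real.exp (ε * ‖u‖ ^ 2)) μ := by
  set M := ∫ u, ‖u‖ ∂μ with hM
  have hexp : ∀ l : ℝ, 0 ≤ l → ∫⁻ u, eexp (l * ‖u‖) ∂μ ≤ eexp (l * M + β * l ^ 2 / 4) := by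
    intro l hl
    have := hGC.lintegral_eexp_le one_pos (g := fun u => ‖u‖)
      (fun u v => by rw [one_mul]; exact abs_norm_sub_norm_le u v) hl
    simpa using this
  -- On the shell at radius n the tilt λ = 2n/β minimises βλ²/4 - λn, a Chernoff gain n²/β. Since
  -- (n+1)² ≤ 2n² + 2, the exponent 1/(4β) spends only half of it.
  refine ⟨1 / (4 * β), by positivity, integrable_exp_of_lintegral_eexp_ne_top (by fun_prop) ?_⟩
  -- on `n ≤ ‖u‖ ≤ n + 1` the integrand is dominated by the `n`-th term
  let F : ℕ → EuclideanSpace ℝ (Fin q) → ℝ≥0∞ := fun n u =>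
    eexp (1 / (4 * β) * (n + 1) ^ 2 - 2 / β * n ^ 2 + 2 / β * n * ‖u‖)
  have hdom : ∀ u, eexp (1 / (4 * β) * ‖u‖ ^ 2) ≤ ∑' n, F n u := by
    intro u
    refine le_trans (eexp_le_eexp ?_) (ENNReal.le_tsum ⌊‖u‖⌋₊)
    have h1 : (⌊‖u‖⌋₊ : ℝ) ≤ ‖u‖ := Nat.floor_le (norm_nonneg u)
    have h2 : ‖u‖ ≤ ⌊‖u‖⌋₊ + 1 := (Nat.lt_floor_add_one _).le
    have h3 : 1 / (4 * β) * ‖u‖ ^ 2 ≤ 1 / (4 * β) * ((⌊‖u‖⌋₊ : ℝ) + 1) ^ 2 := by gcongr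
    have h4 : 0 ≤ 2 / β * ⌊‖u‖⌋₊ * (‖u‖ - ⌊‖u‖⌋₊) :=
      mul_nonneg (by positivity) (sub_nonneg.mpr h1)
    linarith
  have hterm : ∀ n : ℕ, ∫⁻ u, F n u ∂μ ≤ ENNReal.ofReal (Real.exp
      (-(1 / (2 * β)) * n ^ 2 + 2 / β * M * n + 1 / (2 * β))) := by
    intro n
    have e : ∀ u, F n u = eexp (1 / (4 * β) * (n + 1) ^ 2 - 2 / β * n ^ 2)
        * eexp (2 / β * n * ‖u‖) := fun u => eexp_add _ _
    simp_rw [e]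
    rw [lintegral_const_mul' _ _ (eexp_ne_top _)]
    refine (mul_le_mul_right (hexp (2 / β * n) (by positivity)) _).trans ?_
    rw [← eexp_add]
    refine eexp_le_eexp ?_
    have h1 : β * (2 / β * (n : ℝ)) ^ 2 / 4 = 1 / β * n ^ 2 := by field_simp; ring
    have h2 : 1 / (4 * β) * ((n : ℝ) + 1) ^ 2 ≤ 1 / (4 * β) * (2 * n ^ 2 + 2) := by
      gcongr
      nlinarith [sq_nonneg ((n : ℝ) - 1)]
    have h3 : 1 / (4 * β) * (2 * (n : ℝ) ^ 2 + 2) = 1 / (2 * β) * n ^ 2 + 1 / (2 * β) := by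
      field_simp
      ring
    have h4 : 2 / β * (n : ℝ) ^ 2 = 4 * (1 / (2 * β) * n ^ 2) := by field_simp; ring
    have h5 : 1 / β * (n : ℝ) ^ 2 = 2 * (1 / (2 * β) * n ^ 2) := by field_simp
    rw [h1, h5]
    rw [h3] at h2
    linarith
  have hsum : Summable fun n : ℕ => Real.exp
      (-(1 / (2 * β)) * n ^ 2 + 2 / β * M * n + 1 / (2 * β)) := by
    -- Completing the square dominates the Gaussian terms by a geometric series of ratio e^{-1}; the
    -- prefactor is the maximum of the completed square.
    have hgeom : Summable fun n : ℕ =>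
        Real.exp (β / 2 * (2 / β * M + 1) ^ 2 + 1 / (2 * β)) * Real.exp (-1) ^ n :=
      (summable_geometric_of_lt_one (Real.exp_pos _).le (by simp)).mul_left _
    refine Summable.of_nonneg_of_le (fun n => (Real.exp_pos _).le) (fun n => ?_) hgeom
    rw [← Real.exp_nat_mul, ← Real.exp_add]
    refine Real.exp_le_exp.mpr ?_
    have h := sq_nonneg ((n : ℝ) - β * (2 / β * M + 1))
    have h1 : 0 ≤ 1 / (2 * β) * ((n : ℝ) - β * (2 / β * M + 1)) ^ 2 := by positivity
    have h2 : 1 / (2 * β) * ((n : ℝ) - β * (2 / β * M + 1)) ^ 2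
        = 1 / (2 * β) * n ^ 2 - n * (2 / β * M + 1) + β / 2 * (2 / β * M + 1) ^ 2 := by
      field_simp
      ring
    linarith
  have hF : ∀ n, AEMeasurable (F n) μ := fun n =>
    (measurable_eexp.comp (by fun_prop)).aemeasurable
  refine ne_top_of_le_ne_top ?_ ((lintegral_mono hdom).trans_eq (lintegral_tsum hF))
  refine ne_top_of_le_ne_top ?_ (ENNReal.tsum_le_tsum hterm)
  rw [← ENNReal.ofReal_tsum_of_nonneg (fun n => (Real.exp_pos _).le) hsum]
  exact ENNReal.ofReal_ne_top

/-! ### The two regimes -/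

namespace Params

variable {q : ℕ} {μ : Measure (EuclideanSpace ℝ (Fin q))} {p : Params}

theorem rhoBar_pos {ε : ℝ} (hε : 0 < ε) : 0 < p.rhoBar ε := by
  have : 0 < max ε (2 * p.η * p.α * p.Cσ * p.T) := lt_max_of_lt_left hε
  rw [rhoBar]
  positivity

theorem rhoBar_mul_exp_le {ε : ℝ} (hε : 0 < ε) :
    p.rhoBar ε * Real.exp (p.C * p.T) ≤ 1 / 2 ∧
    p.rhoBar ε * Real.exp (p.C * p.T) * (2 * p.η * p.α * p.Cσ * p.T) ≤ 1 / 2 * ε := by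
  set X := 2 * p.η * p.α * p.Cσ * p.T with hX
  have hm : 0 < max ε X := lt_max_of_lt_left hε
  have e : p.rhoBar ε * Real.exp (p.C * p.T) = 1 / 2 * (ε / max ε X) := by
    have h1 : Real.exp (-(p.C * p.T)) * Real.exp (p.C * p.T) = 1 := by
      rw [← Real.exp_add]; simp
    rw [rhoBar, ← hX]
    linear_combination (1 / 2 * (ε / max ε X)) * h1
  rw [e]
  constructor
  · have : ε / max ε X ≤ 1 := (div_le_one hm).mpr (le_max_left _ _)
    linarith
  · have : ε / max ε X * X ≤ ε := by
      rw [div_mul_eq_mul_div, div_le_iff₀ hm]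
      exact mul_le_mul_of_nonneg_left (le_max_right _ _) hε.le
    linarith

theorem integrable_exp_mul_norm_sq_of_le {a ε : ℝ} (h : a ≤ ε)
    (hε : Integrable (fun u => Real.exp (ε * ‖u‖ ^ 2)) μ) :
    Integrable (fun u => Real.exp (a * ‖u‖ ^ 2)) μ := by
  refine hε.mono' (by fun_prop) ?_
  filter_upwards with u
  rw [Real.norm_of_nonneg (Real.exp_pos _).le]
  gcongr

variable [IsProbabilityMeasure μ]

theorem one_le_integral_exp_mul_norm_sq {a : ℝ} (ha : 0 ≤ a)
    (hi : Integrable (fun u => Real.exp (a * ‖u‖ ^ 2)) μ) :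
    1 ≤ ∫ u, Real.exp (a * ‖u‖ ^ 2) ∂μ := by
  have := integral_mono (integrable_const 1) hi
    fun u => Real.one_le_exp (mul_nonneg ha (sq_nonneg ‖u‖))
  simpa using this

theorem lintegral_eexp_mul_norm_sq_eq {a : ℝ} (ha : 0 ≤ a)
    (hi : Integrable (fun u => Real.exp (a * ‖u‖ ^ 2)) μ) :
    ∫⁻ u, eexp (a * ‖u‖ ^ 2) ∂μ = eexp (Real.log (∫ u, Real.exp (a * ‖u‖ ^ 2) ∂μ)) := by
  rw [lintegral_eexp_eq hi, eexp, Real.exp_log]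
  linarith [one_le_integral_exp_mul_norm_sq ha hi]

theorem Valid.ratio_mem (hp : p.Valid) : 0 ≤ (1 - p.α) / p.α ∧ (1 - p.α) / p.α ≤ 1 := by
  have hα := hp.α_pos
  refine ⟨div_nonneg (by linarith [hp.α_le]) hα.le, (div_le_one hα).mpr ?_⟩
  linarith [hp.α_ge]

theorem logMoment_nonneg (hp : p.Valid) {ε : ℝ} (hε : 0 < ε)
    (hi : Integrable (fun u => Real.exp (ε * ‖u‖ ^ 2)) μ) : 0 ≤ p.logMoment μ ε := by
  obtain ⟨h0, h1⟩ := hp.ratio_mem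
  have e : ε * (1 - p.α) / (2 * p.α) = ε / 2 * ((1 - p.α) / p.α) := by ring
  have ha : 0 ≤ ε * (1 - p.α) / (2 * p.α) := by rw [e]; positivity
  have hle : ε * (1 - p.α) / (2 * p.α) ≤ ε := by rw [e]; nlinarith
  have := Real.log_nonneg (one_le_integral_exp_mul_norm_sq ha
    (integrable_exp_mul_norm_sq_of_le hle hi))
  rw [logMoment]
  linarith

/-- Young's inequality separating `V ^ (1 - α)` from `V ^ α`. -/
theorem Valid.young (hp : p.Valid) (hα : 1 / 2 < p.α) {c r v : ℝ} (hc : 0 < c) (hr : 0 < r)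
    (hv : 0 < v) :
    r * v ^ (1 - p.α) ≤ c ^ (-((1 - p.α) / (2 * p.α - 1))) * ((2 * p.α - 1) / p.α)
        * r ^ (p.α / (2 * p.α - 1)) + c * ((1 - p.α) / p.α) * v ^ p.α := by
  have h0 := hp.α_pos
  have h1 : 0 < 2 * p.α - 1 := by linarith
  -- The weights sum to 1, and the power of c in the first factor is chosen to cancel the one
  -- produced by the second.
  have h := Real.geom_mean_le_arith_mean2_weighted (w₁ := (2 * p.α - 1) / p.α)
    (w₂ := (1 - p.α) / p.α)
    (p₁ := r ^ (p.α / (2 * p.α - 1)) * c ^ (-((1 - p.α) / (2 * p.α - 1))))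
    (p₂ := c * v ^ p.α) (by positivity) hp.ratio_mem.1 (by positivity) (by positivity)
    (by field_simp; ring)
  rw [Real.mul_rpow (by positivity) (by positivity), Real.mul_rpow hc.le (by positivity),
    ← Real.rpow_mul hr.le, ← Real.rpow_mul hc.le, ← Real.rpow_mul hv.le] at h
  have h2 : p.α * 2 - 1 ≠ 0 := by linarith
  have e1 : p.α / (2 * p.α - 1) * ((2 * p.α - 1) / p.α) = 1 := by field_simp
  have e2 : -((1 - p.α) / (2 * p.α - 1)) * ((2 * p.α - 1) / p.α) = -((1 - p.α) / p.α) := by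
    field_simp
  have e3 : p.α * ((1 - p.α) / p.α) = 1 - p.α := by field_simp
  have e4 : c ^ (-((1 - p.α) / p.α)) * c ^ ((1 - p.α) / p.α) = 1 := by
    rw [← Real.rpow_add hc]; simp
  rw [e1, e2, e3, Real.rpow_one] at h
  calc r * v ^ (1 - p.α)
      = r * c ^ (-((1 - p.α) / p.α)) * (c ^ ((1 - p.α) / p.α) * v ^ (1 - p.α)) := by
        linear_combination (- r * v ^ (1 - p.α)) * e4
    _ ≤ _ := h.trans (le_of_eq (by ring))

theorem Psi2_pos (hp : p.Valid) (hα : 1 / 2 < p.α) {ε v : ℝ} (hε : 0 < ε) (hv : 0 < v)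
    (hi : Integrable (fun u => Real.exp (ε * ‖u‖ ^ 2)) μ) : 0 < p.Psi2 μ ε v := by
  have h0 := hp.α_pos
  have h1 : 0 < 2 * p.α - 1 := by linarith
  have h2 := rhoBar_pos (p := p) hε
  have h3 := logMoment_nonneg hp hε hi
  have h4 := hp.ratio_mem.1
  have h5 : 0 < p.rhoBar ε ^ (-((1 - p.α) / (2 * p.α - 1))) * ((2 * p.α - 1) / p.α) := by
    positivity
  have h6 : 0 ≤ p.rhoBar ε * ((1 - p.α) / p.α) * Real.exp (p.C * p.T) * v ^ p.α := by positivity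
  rw [Psi2]
  linarith

theorem Psi_pos (hp : p.Valid) (hα : 1 / 2 < p.α) {ε v : ℝ} (hε : 0 < ε) (hv : 0 < v)
    (hi : Integrable (fun u => Real.exp (ε * ‖u‖ ^ 2)) μ) : 0 < p.Psi μ ε v :=
  mul_pos (lt_max_of_lt_right (Psi2_pos hp hα hε hv hi)) (lt_max_of_lt_left hp.φ_pos)

/-- The two values of R are those met for φ t² ≤ 1 and φ t² ≥ 1; each is at most the product of the
two maxima. `Psi1` enters only through the maximum with `Psi2`, which already suffices. -/
theorem half_Psi2_mul_le (hp : p.Valid) (hα : 1 / 2 < p.α) {ε v t R : ℝ} (hε : 0 < ε)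
    (hv : 0 < v) (hi : Integrable (fun u => Real.exp (ε * ‖u‖ ^ 2)) μ) (ht : 0 < t)
    (hR : R = p.φ * t ^ 2 ∨ R = (p.φ * t ^ 2) ^ (p.α / (2 * p.α - 1))) :
    1 / 2 * (p.Psi2 μ ε v * R)
      ≤ p.Psi μ ε v * max (t ^ 2) (t ^ (2 * p.α / (2 * p.α - 1))) := by
  have hφ := hp.φ_pos
  have hΨ := Psi2_pos hp hα hε hv hi
  have hR' : 0 ≤ R ∧ R ≤ max p.φ (p.φ ^ (p.α / (2 * p.α - 1)))
      * max (t ^ 2) (t ^ (2 * p.α / (2 * p.α - 1))) := by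
    rcases hR with rfl | rfl
    · refine ⟨by positivity, mul_le_mul (le_max_left _ _) (le_max_left _ _) (by positivity) ?_⟩
      exact hφ.le.trans (le_max_left _ _)
    · refine ⟨by positivity, ?_⟩
      rw [Real.mul_rpow hφ.le (by positivity), ← Real.rpow_natCast t 2, ← Real.rpow_mul ht.le]
      refine mul_le_mul (le_max_right _ _) ?_ (by positivity) (hφ.le.trans (le_max_left _ _))
      refine le_trans (le_of_eq ?_) (le_max_right _ _)
      congr 1
      push_cast
      ring
  rw [Psi, mul_assoc]
  have h1 : p.Psi2 μ ε v * R ≤ max (p.Psi1 μ ε v) (p.Psi2 μ ε v)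
      * (max p.φ (p.φ ^ (p.α / (2 * p.α - 1)))
        * max (t ^ 2) (t ^ (2 * p.α / (2 * p.α - 1)))) :=
    mul_le_mul (le_max_right _ _) hR'.2 hR'.1 (hΨ.le.trans (le_max_right _ _))
  have h2 := mul_nonneg hΨ.le hR'.1
  linarith

theorem exists_admissible (hp : p.Valid) (hη : 0 ≤ p.η) {ε : ℝ} (hε : 0 < ε)
    (hi : Integrable (fun u => Real.exp (ε * ‖u‖ ^ 2)) μ) : ∃ l : ℝ, p.Admissible μ l := by
  have h0 := hp.α_pos
  have hCσ := hp.Cσ_pos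
  have hT := hp.T_pos
  set a := 2 * p.η * p.α * p.Cσ * p.T * Real.exp (p.C * p.T) with ha
  have ha0 : 0 ≤ a := by positivity
  set I := Real.log (∫ u, Real.exp (ε * ‖u‖ ^ 2) ∂μ) with hI
  have hI0 : 0 ≤ I := Real.log_nonneg (one_le_integral_exp_mul_norm_sq hε.le hi)
  have hlog2 : 0 < Real.log 2 := Real.log_pos (by norm_num)
  -- This power brings the known moment e^I down to at most 2 by Jensen.
  set θ := Real.log 2 / (Real.log 2 + I) with hθ
  have hθ0 : 0 < θ := by positivity
  have hθ1 : θ ≤ 1 := (div_le_one (by positivity)).mpr (by linarith)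
  have hθI : I * θ ≤ Real.log 2 := by
    rw [hθ, mul_div_assoc', div_le_iff₀ (by positivity)]
    nlinarith
  -- This is the value of l². Dividing by a + 1 instead of a covers η = 0, where a = 0.
  set r := min (Real.exp (-(p.C * p.T))) (ε * θ / (a + 1)) with hr
  have hr0 : 0 < r := lt_min (Real.exp_pos _) (by positivity)
  have hra : r * a ≤ ε * θ := by
    have h1 : r ≤ ε * θ / (a + 1) := min_le_right _ _
    rw [le_div_iff₀ (by positivity)] at h1
    linarith
  have hle : ∫⁻ u, eexp (r * a * ‖u‖ ^ 2) ∂μ ≤ eexp (Real.log 2) := by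
    calc ∫⁻ u, eexp (r * a * ‖u‖ ^ 2) ∂μ ≤ ∫⁻ u, eexp (ε * ‖u‖ ^ 2 * θ) ∂μ := by
          refine lintegral_mono fun u => eexp_le_eexp ?_
          have := mul_le_mul_of_nonneg_right hra (sq_nonneg ‖u‖)
          linarith
      _ ≤ (∫⁻ u, eexp (ε * ‖u‖ ^ 2) ∂μ) ^ θ :=
          lintegral_eexp_mul_le (by fun_prop) hθ0.le hθ1
      _ = eexp (I * θ) := by rw [lintegral_eexp_mul_norm_sq_eq hε.le hi, eexp_rpow]
      _ ≤ _ := eexp_le_eexp hθI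
  obtain ⟨h1, h2⟩ := integrable_exp_and_integral_le (by fun_prop) hle
  rw [Real.exp_log (by norm_num)] at h2
  have hsq : Real.sqrt r ^ 2 = r := Real.sq_sqrt hr0.le
  refine ⟨Real.sqrt r, Real.sqrt_pos.mpr hr0, ?_, ?_, ?_⟩
  · rw [hsq]; exact min_le_left _ _
  · rw [hsq]; exact h1
  · rw [hsq]; exact h2

end Params

/-! ### Laplace bounds for α > 1/2 and for α = 1/2 -/

section Regimes

variable {d q : ℕ} {Ω : Type*} [MeasurableSpace Ω] {P : Measure Ω} [IsProbabilityMeasure P]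
  {U : ℕ → Ω → EuclideanSpace ℝ (Fin q)}
  {μ : Measure (EuclideanSpace ℝ (Fin q))} [IsProbabilityMeasure μ]
  {p : Params} {b : ℝ → EuclideanSpace ℝ (Fin d) → EuclideanSpace ℝ (Fin d)}
  {σ : ℝ → EuclideanSpace ℝ (Fin d) → Matrix (Fin d) (Fin q) ℝ}
  {V : EuclideanSpace ℝ (Fin d) → ℝ}

theorem integral_exp_lipschitz_le_of_half_lt (hU_indep : iIndepFun U P)
    (hU_law : ∀ i, HasLaw (U i) μ P) (hμ : IsStandardized μ) (hp : p.Valid)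
    (hGC : GaussianConcentration μ p.β) (hHS : p.Smooth b σ) (hHD : p.Dominated b σ V)
    (x : EuclideanSpace ℝ (Fin d)) (hα : 1 / 2 < p.α) {ε : ℝ} (hε : 0 < ε)
    (hi : Integrable (fun u => Real.exp (ε * ‖u‖ ^ 2)) μ) {t : ℝ} (ht : 0 < t)
    {f : EuclideanSpace ℝ (Fin d) → ℝ} (hf : LipschitzWith 1 f) :
    Integrable (fun y => Real.exp (t * f y)) (P.map (eulerScheme b σ p.Δ x U p.N)) ∧
    ∫ y, Real.exp (t * f y) ∂(P.map (eulerScheme b σ p.Δ x U p.N))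
      ≤ Real.exp (t * ∫ y, f y ∂(P.map (eulerScheme b σ p.Δ x U p.N))
        + p.Psi μ ε (V x) * max (t ^ 2) (t ^ (2 * p.α / (2 * p.α - 1)))) := by
  have h0 := hp.α_pos
  have h1 : 0 < 2 * p.α - 1 := by linarith
  have hφ := hp.φ_pos
  have hρ := Params.rhoBar_pos (p := p) hε
  have hL := Params.logMoment_nonneg hp hε hi
  have hv := hHD.pos x
  obtain ⟨hk0, hk1⟩ := hp.ratio_mem
  set κ := (1 - p.α) / p.α with hκ
  set B := p.rhoBar ε ^ (-((1 - p.α) / (2 * p.α - 1))) * ((2 * p.α - 1) / p.α) with hB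
  have hB0 : 0 ≤ B := by positivity
  set c := p.rhoBar ε * κ with hc
  have hc0 : 0 ≤ c := by positivity
  set E := Real.exp (p.C * p.T) with hE
  have hE0 : 0 < E := Real.exp_pos _
  set r := p.φ * t ^ 2 with hr
  have hr0 : 0 < r := by positivity
  obtain ⟨hb1, hb2⟩ := Params.rhoBar_mul_exp_le (p := p) hε
  rw [← hE] at hb1 hb2
  have hcE : c * E ≤ 1 := by
    have : c * E = p.rhoBar ε * E * κ := by rw [hc]; ring
    rw [this]
    nlinarith [mul_nonneg hρ.le hE0.le]
  have ha0 : 0 ≤ ε * (1 - p.α) / (2 * p.α) :=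
    div_nonneg (mul_nonneg hε.le (by linarith [hp.α_le])) (by positivity)
  have hae : ε * (1 - p.α) / (2 * p.α) = 1 / 2 * ε * κ := by rw [hκ]; field_simp
  have haε : ε * (1 - p.α) / (2 * p.α) ≤ ε := by rw [hae]; nlinarith
  -- The definition of ρ̄ makes the coefficient at most ε(1-α)/(2α), the exponent in the definition
  -- of `logMoment`.
  have hm : ∫⁻ u, eexp (c * E * (2 * p.η * p.α * p.Cσ * p.T) * ‖u‖ ^ 2) ∂μ
      ≤ eexp (2 * p.logMoment μ ε) := by
    have e : 2 * p.logMoment μ ε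
        = Real.log (∫ u, Real.exp (ε * (1 - p.α) / (2 * p.α) * ‖u‖ ^ 2) ∂μ) := by
      rw [Params.logMoment]; ring
    rw [e, ← Params.lintegral_eexp_mul_norm_sq_eq ha0
      (Params.integrable_exp_mul_norm_sq_of_le haε hi)]
    refine lintegral_mono fun u => eexp_le_eexp ?_
    refine mul_le_mul_of_nonneg_right ?_ (sq_nonneg _)
    rw [hae]
    have := mul_le_mul_of_nonneg_right hb2 hk0
    rw [hc]
    linarith
  have hΨ : p.Psi2 μ ε (V x) = B + c * E * V x ^ p.α + p.logMoment μ ε := by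
    rw [Params.Psi2]
  -- For r = φ t² ≥ 1, Young is used with c fixed and only A grows, the other terms being enlarged
  -- by the factor R ≥ 1. For r ≤ 1, Young at 1 is multiplied by r and Jensen scales the moment by
  -- r, so every term is linear in r and the bound is quadratic in t.
  rcases le_total 1 r with hr1 | hr1
  · have hR : 1 ≤ r ^ (p.α / (2 * p.α - 1)) := Real.one_le_rpow hr1 (by positivity)
    obtain ⟨hI, hle⟩ := integral_exp_lipschitz_map_eulerScheme_le hU_indep hU_law hμ hp hGC hHS
      hHD x ht (A := B * r ^ (p.α / (2 * p.α - 1))) (by positivity) hc0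
      (fun y => hp.young hα hρ hr0 (hHD.pos y)) hcE hm hf
    refine ⟨hI, hle.trans (Real.exp_le_exp.mpr (add_le_add_right ?_ _))⟩
    refine le_trans ?_ (Params.half_Psi2_mul_le hp hα hε hv hi ht (Or.inr rfl))
    rw [hΨ, ← hr, ← hE]
    have h3 : 0 ≤ c * E * V x ^ p.α := by positivity
    nlinarith [mul_nonneg h3 (sub_nonneg.mpr hR), mul_nonneg hL (sub_nonneg.mpr hR)]
  · have hm' : ∫⁻ u, eexp (c * r * E * (2 * p.η * p.α * p.Cσ * p.T) * ‖u‖ ^ 2) ∂μ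
        ≤ eexp (2 * p.logMoment μ ε * r) := by
      calc _ = ∫⁻ u, eexp (c * E * (2 * p.η * p.α * p.Cσ * p.T) * ‖u‖ ^ 2 * r) ∂μ := by
            refine lintegral_congr fun u => ?_
            congr 1
            ring
        _ ≤ (∫⁻ u, eexp (c * E * (2 * p.η * p.α * p.Cσ * p.T) * ‖u‖ ^ 2) ∂μ) ^ r :=
            lintegral_eexp_mul_le (by fun_prop) hr0.le hr1
        _ ≤ eexp (2 * p.logMoment μ ε) ^ r := by gcongr
        _ = _ := eexp_rpow _ _
    have hcr : c * r * E ≤ 1 := by nlinarith [mul_nonneg hc0 hE0.le]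
    obtain ⟨hI, hle⟩ := integral_exp_lipschitz_map_eulerScheme_le hU_indep hU_law hμ hp hGC hHS
      hHD x ht (A := B * r) (c := c * r) (by positivity) (by positivity)
      (fun y => by
        have h := hp.young hα hρ one_pos (hHD.pos y)
        rw [Real.one_rpow, one_mul, mul_one] at h
        have := mul_le_mul_of_nonneg_left h hr0.le
        rw [← hr, hc]
        linarith) hcr hm' hf
    refine ⟨hI, hle.trans (Real.exp_le_exp.mpr (add_le_add_right ?_ _))⟩
    refine le_trans (le_of_eq ?_) (Params.half_Psi2_mul_le hp hα hε hv hi ht (Or.inl rfl))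
    rw [hΨ, ← hr, ← hE]
    ring

theorem integral_exp_lipschitz_le_of_eq_half (hU_indep : iIndepFun U P)
    (hU_law : ∀ i, HasLaw (U i) μ P) (hμ : IsStandardized μ) (hp : p.Valid)
    (hGC : GaussianConcentration μ p.β) (hHS : p.Smooth b σ) (hHD : p.Dominated b σ V)
    (x : EuclideanSpace ℝ (Fin d)) (hα : p.α = 1 / 2) {l : ℝ} (hl : p.Admissible μ l)
    {t : ℝ} (ht : 0 < t) (htl : t < l / Real.sqrt p.φ)
    {f : EuclideanSpace ℝ (Fin d) → ℝ} (hf : LipschitzWith 1 f) :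
    Integrable (fun y => Real.exp (t * f y)) (P.map (eulerScheme b σ p.Δ x U p.N)) ∧
    ∫ y, Real.exp (t * f y) ∂(P.map (eulerScheme b σ p.Δ x U p.N))
      ≤ Real.exp (t * ∫ y, f y ∂(P.map (eulerScheme b σ p.Δ x U p.N))
        + p.KHalf μ (V x) l * ((t * Real.sqrt p.φ / l) ^ 2 / (1 - t * Real.sqrt p.φ / l))) := by
  have h0 := hp.α_pos
  have hφ := hp.φ_pos
  have hl0 := hl.pos
  have hCσ := hp.Cσ_pos
  have hT := hp.T_pos
  have hη := hHD.η_nonneg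
  have hsφ : 0 < Real.sqrt p.φ := Real.sqrt_pos.mpr hφ
  set E := Real.exp (p.C * p.T) with hE
  have hE0 : 0 < E := Real.exp_pos _
  set s := t * Real.sqrt p.φ / l with hs
  have hs0 : 0 < s := by positivity
  have hs1 : s < 1 := by
    rw [hs, div_lt_one hl0]
    rwa [lt_div_iff₀ hsφ] at htl
  -- Since V^{1-α} = V^α here, absorption holds with A = 0 and c = φ t² = s² l²; the condition s < 1
  -- keeps c e^{CT} ≤ 1.
  have hr : p.φ * t ^ 2 = s ^ 2 * l ^ 2 := by
    rw [hs, div_pow, mul_pow, Real.sq_sqrt hφ.le]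
    field_simp
  have hs2 : s ^ 2 ≤ 1 := by nlinarith
  have hlE : l ^ 2 * E ≤ 1 := by
    have h := mul_le_mul_of_nonneg_right hl.sq_le hE0.le
    rwa [hE, ← Real.exp_add, neg_add_cancel, Real.exp_zero] at h
  have hlE0 : 0 ≤ l ^ 2 * E := by positivity
  have hm : ∫⁻ u, eexp (s ^ 2 * l ^ 2 * E * (2 * p.η * p.α * p.Cσ * p.T) * ‖u‖ ^ 2) ∂μ
      ≤ eexp (Real.log 2 * s ^ 2) := by
    calc _ = ∫⁻ u, eexp (l ^ 2 * (2 * p.η * p.α * p.Cσ * p.T * E) * ‖u‖ ^ 2 * s ^ 2) ∂μ := by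
          refine lintegral_congr fun u => ?_
          congr 1
          ring
      _ ≤ (∫⁻ u, eexp (l ^ 2 * (2 * p.η * p.α * p.Cσ * p.T * E) * ‖u‖ ^ 2) ∂μ) ^ (s ^ 2) :=
          lintegral_eexp_mul_le (by fun_prop) (by positivity) hs2
      _ ≤ eexp (Real.log 2) ^ (s ^ 2) := by
          gcongr
          rw [lintegral_eexp_eq hl.integrable, eexp, Real.exp_log (by norm_num)]
          exact ENNReal.ofReal_le_ofReal hl.le_two
      _ = _ := eexp_rpow _ _
  have hcE : s ^ 2 * l ^ 2 * E ≤ 1 := by nlinarith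
  obtain ⟨hI, hle⟩ := integral_exp_lipschitz_map_eulerScheme_le hU_indep hU_law hμ hp hGC hHS
    hHD x ht (A := 0) (c := s ^ 2 * l ^ 2) le_rfl (by positivity)
    (fun y => by
      have : 1 - p.α = p.α := by rw [hα]; norm_num
      rw [hr, this, zero_add]) hcE hm hf
  refine ⟨hI, hle.trans (Real.exp_le_exp.mpr (add_le_add_right ?_ _))⟩
  rw [← hE, zero_add]
  set K := p.KHalf μ (V x) l with hK
  have hK1 : 1 ≤ K := le_max_left _ _
  have hK2 : l ^ 2 * E * (2 * V x ^ p.α) ≤ K := by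
    refine le_trans ?_ (le_max_right _ _)
    rw [← hE, Real.sqrt_eq_rpow, hα]
    refine mul_le_mul_of_nonneg_left ?_ hlE0
    have h1 : 0 ≤ ∫ u, ‖u‖ ^ 2 ∂μ := integral_nonneg fun _ => sq_nonneg _
    have h2 : 0 ≤ 2 * p.η * (1 / 2) * p.Cσ * (∫ u, ‖u‖ ^ 2 ∂μ) * p.T := by positivity
    linarith
  have hlog : Real.log 2 ≤ 1 := by
    have := Real.log_le_sub_one_of_pos (x := 2) (by norm_num)
    linarith
  have h1 : 1 / 2 * (s ^ 2 * l ^ 2 * E * V x ^ p.α) + Real.log 2 * s ^ 2 / 4 ≤ K * s ^ 2 := by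
    nlinarith [sq_nonneg s, mul_le_mul_of_nonneg_right hK2 (sq_nonneg s),
      mul_le_mul_of_nonneg_right (hlog.trans hK1) (sq_nonneg s)]
  -- The estimate obtained is purely quadratic in s; the denominator of Φ_{1/2} only weakens it.
  have h2 : s ^ 2 ≤ s ^ 2 / (1 - s) :=
    le_div_self (sq_nonneg s) (by linarith) (by linarith)
  exact h1.trans (mul_le_mul_of_nonneg_left h2 (by linarith))

end Regimes

end EulerTE

/-! ### Conclusion by duality -/

theorem mainTheorem1 {d q : ℕ} {Ω : Type*} [MeasurableSpace Ω]
    (P : Measure Ω) [IsProbabilityMeasure P]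
    (U : ℕ → Ω → EuclideanSpace ℝ (Fin q))
    (μ : Measure (EuclideanSpace ℝ (Fin q))) [IsProbabilityMeasure μ]
    (hU_indep : iIndepFun U P) (hU_law : ∀ i, HasLaw (U i) μ P)
    (hμ : EulerTE.IsStandardized μ)
    (p : EulerTE.Params) (hp : p.Valid)
    (hGC : EulerTE.GaussianConcentration μ p.β)
    (b : ℝ → EuclideanSpace ℝ (Fin d) → EuclideanSpace ℝ (Fin d))
    (σ : ℝ → EuclideanSpace ℝ (Fin d) → Matrix (Fin d) (Fin q) ℝ)
    (V : EuclideanSpace ℝ (Fin d) → ℝ)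
    (hHS : p.Smooth b σ) (hHD : p.Dominated b σ V)
    (x : EuclideanSpace ℝ (Fin d)) :
    (∃ ε : ℝ, 0 < ε ∧ Integrable (fun u => Real.exp (ε * ‖u‖ ^ 2)) μ) ∧
    (1 / 2 < p.α →
      ∀ ε : ℝ, 0 < ε → Integrable (fun u => Real.exp (ε * ‖u‖ ^ 2)) μ →
        EulerTE.TransportEntropy (EulerTE.monotoneConjugate (p.Phi μ ε (V x)))
          (P.map (EulerTE.eulerScheme b σ p.Δ x U p.N))) ∧
    (p.α = 1 / 2 →
      (∃ l : ℝ, p.Admissible μ l) ∧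
      ∀ l : ℝ, p.Admissible μ l →
        EulerTE.TransportEntropy (EulerTE.monotoneConjugate (p.PhiHalf μ (V x) l))
          (P.map (EulerTE.eulerScheme b σ p.Δ x U p.N))) := by
  have hsq := hGC.exists_integrable_exp_norm_sq hp.β_pos
  have hX := EulerTE.aemeasurable_eulerScheme (fun i => (hU_law i).aemeasurable) hp hHS x
    (le_refl p.N)
  have hprob : IsProbabilityMeasure (P.map (EulerTE.eulerScheme b σ p.Δ x U p.N)) :=
    Measure.isProbabilityMeasure_map hX
  have hnorm := EulerTE.integrable_norm_map_eulerScheme hμ hU_indep hU_law hp hHS x (le_refl p.N)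
  have hφ : 0 < Real.sqrt p.φ := Real.sqrt_pos.mpr hp.φ_pos
  refine ⟨hsq, fun hα ε hε hi => ?_, fun hα => ⟨?_, fun l hl => ?_⟩⟩
  · have hΨ := EulerTE.Params.Psi_pos hp hα hε (hHD.pos x) hi
    have h1 : 0 < 2 * p.α - 1 := by linarith
    refine ⟨EulerTE.isTransportFunction_conjugate_max_pow _ _ _ hΨ ?_ fun ρ => rfl,
      fun ν hν => EulerTE.monotoneConjugate_wasserstein1_le_klDiv _ _ hnorm
        ⟨1, one_pos, ENNReal.ofReal_ne_top⟩ (fun f hf t ht _ => ?_) ν⟩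
    · rw [le_div_iff₀ h1]
      linarith [hp.α_le]
    · rw [EulerTE.Params.Phi, ENNReal.toReal_ofReal (by positivity)]
      exact EulerTE.integral_exp_lipschitz_le_of_half_lt hU_indep hU_law hμ hp hGC hHS hHD x hα hε
        hi ht hf
  · obtain ⟨ε, hε, hi⟩ := hsq
    exact EulerTE.Params.exists_admissible hp hHD.η_nonneg hε hi
  · have hl0 := hl.pos
    have hK : 0 < p.KHalf μ (V x) l := lt_max_of_lt_left one_pos
    have hR : 0 < l / Real.sqrt p.φ := by positivity
    refine ⟨EulerTE.isTransportFunction_conjugate_restricted _ (p.KHalf μ (V x) l)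
      (Real.sqrt p.φ / l) (l / Real.sqrt p.φ) hK (by positivity) hR (by field_simp)
      (fun ρ hρ => ?_) (fun ρ hρ => ?_),
      fun ν hν => EulerTE.monotoneConjugate_wasserstein1_le_klDiv _ _ hnorm
        -- Any point inside the domain serves as a positive argument with finite value; the midpoint
        -- is taken.
        ⟨(l / Real.sqrt p.φ / 2).toNNReal, ?_, ?_⟩ (fun f hf t ht hfin => ?_) ν⟩
    · rw [EulerTE.Params.PhiHalf, if_pos hρ, mul_div_assoc]
    · rw [EulerTE.Params.PhiHalf, if_neg (not_lt.mpr hρ)]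
    · exact Real.toNNReal_pos.mpr (by positivity)
    · rw [EulerTE.Params.PhiHalf, if_pos]
      · exact ENNReal.ofReal_ne_top
      · rw [Real.coe_toNNReal _ (by positivity)]
        linarith
    · have htl : (t : ℝ) < l / Real.sqrt p.φ := by
        by_contra h
        exact hfin (by rw [EulerTE.Params.PhiHalf, if_neg h])
      have hs1 : (t : ℝ) * Real.sqrt p.φ / l < 1 := by
        rw [div_lt_one hl0]
        rwa [lt_div_iff₀ hφ] at htl
      have hs1' : 0 < 1 - (t : ℝ) * Real.sqrt p.φ / l := by linarith
      rw [EulerTE.Params.PhiHalf, if_pos htl, ENNReal.toReal_ofReal (by positivity)]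
      exact EulerTE.integral_exp_lipschitz_le_of_eq_half hU_indep hU_law hμ hp hGC hHS hHD x hα hl
        ht htl hf
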